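/- A process $X=(X_i)_{i\in\mathbb Z}$ is stationary if $(X_i)_{i\in\mathbb Z}$ and $(X_{i+1})_{i\in\mathbb Z}$ are equal in law. It is $k$-dependent if for each $i\in\mathbb Z$ the sequences $(\ldots,X_{i-2},X_{i-1})$ and $(X_{i+k},X_{i+k+1},\ldots)$ are independent. It is a $q$-coloring (of $\mathbb Z$) if each $X_i$ takes values in $\{1,\ldots,q\}$ and almost surely $X_i\ne X_{i+1}$ for all $i\in\mathbb Z$. Write $\mathbf 1[\cdot]$ for an indicator. **Theorem 1.4.** There exist a stationary $1$-dependent $4$-coloring $X$ and a stationary $2$-dependent $3$-coloring $Y$ with all of the following properties. (i) The processes are reversible and symmetric under permutations of the colors: $X$ is equal in law to $(X_{-i})_{i\in\mathbb Z}$, and to $(\sigma(X_i))_{i\in\mathbb Z}$ for every $\sigma\in S_4$; similarly $Y$ is equal in law to $(Y_{-i})_{i\in\mathbb Z}$, and to $(\sigma(Y_i))_{i\in\mathbb Z}$ for every $\sigma\in S_3$. (ii) The process $(\mathbf 1[X_i=1])_{i\in\mathbb Z}$ is equal in law to $(\mathbf 1[B_i>B_{i+1}])_{i\in\mathbb Z}$,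 where $(B_i)_{i\in\mathbb Z}$ are i.i.d. taking the values $0,1$ with equal probabilities. (iii) The process $(\mathbf 1[X_i\in\{1,2\}])_{i\in\mathbb Z}$ is equal in law to $(\mathbf 1[U_i>U_{i+1}])_{i\in\mathbb Z}$, where $(U_i)_{i\in\mathbb Z}$ are i.i.d. uniform on $[0,1]$. (iv) The process $(\mathbf 1[Y_i=1])_{i\in\mathbb Z}$ is equal in law to $(\mathbf 1[U_{i-1}<U_i>U_{i+1}])_{i\in\mathbb Z}$, where $(U_i)_{i\in\mathbb Z}$ are i.i.d. uniform on $[0,1]$. (v) For every $n$, the law of $(Y_1,\ldots,Y_n)$ is the conditional law of $(X_1,\ldots,X_n)$ given that $X_i\ne 4$ for $i=1,\ldots,n$. Moreover, every stationary $1$-dependent $4$-coloring $X$ satisfies (ii). -/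

import Mathlib

open MeasureTheory ProbabilityTheory

/-- `X` is stationary: `(X i)` and `(X (i+1))` are equal in law. -/
def IsStationaryProcess {Ω S : Type*} [MeasurableSpace Ω] [MeasurableSpace S]
    (X : ℤ → Ω → S) (P : Measure Ω) : Prop :=
  IdentDistrib (fun ω (i : ℤ) => X i ω) (fun ω (i : ℤ) => X (i + 1) ω) P P

/-- `X` is `k`-dependent: for each `i`, the sequences `(…, X (i-2), X (i-1))` and
`(X (i+k), X (i+k+1), …)` are independent of each other. -/
def IsDependent {Ω S : Type*} [MeasurableSpace Ω] [MeasurableSpace S]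
    (k : ℕ) (X : ℤ → Ω → S) (P : Measure Ω) : Prop :=
  ∀ i : ℤ, IndepFun (fun ω (j : Set.Iio i) => X j ω)
    (fun ω (j : Set.Ici (i + (k : ℤ))) => X j ω) P

/-- `X` is a stationary `k`-dependent `q`-coloring of `ℤ`. The colors `1, …, q` are represented
by the elements `0, …, q - 1` of `Fin q`. -/
structure IsDependentColoring {Ω : Type*} [MeasurableSpace Ω] (k q : ℕ)
    (X : ℤ → Ω → Fin q) (P : Measure Ω) : Prop where
  measurable : ∀ i, Measurable (X i)
  proper : ∀ᵐ ω ∂P, ∀ i : ℤ, X i ω ≠ X (i + 1) ω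
  stationary : IsStationaryProcess X P
  dependent : IsDependent k X P

/-- `X` is reversible: `(X i)` and `(X (-i))` are equal in law. -/
def IsReversible {Ω S : Type*} [MeasurableSpace Ω] [MeasurableSpace S]
    (X : ℤ → Ω → S) (P : Measure Ω) : Prop :=
  IdentDistrib (fun ω (i : ℤ) => X i ω) (fun ω (i : ℤ) => X (-i) ω) P P

/-- `X` is symmetric under permutations of the colors. -/
def IsColorSymmetric {Ω : Type*} [MeasurableSpace Ω] {q : ℕ}
    (X : ℤ → Ω → Fin q) (P : Measure Ω) : Prop :=
  ∀ σ : Equiv.Perm (Fin q),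
    IdentDistrib (fun ω (i : ℤ) => X i ω) (fun ω (i : ℤ) => σ (X i ω)) P P

open Classical in
/-- The indicator `1[p]`. -/
noncomputable def ind (p : Prop) : ℕ := if p then 1 else 0

/-- The law of an i.i.d. sequence `(B i)`, `i ∈ ℤ`, of fair bits with values `0, 1`. -/
noncomputable def fairBits : Measure (ℤ → Fin 2) :=
  Measure.infinitePi fun _ : ℤ => (PMF.uniformOfFintype (Fin 2)).toMeasure

/-- The law of an i.i.d. sequence `(U i)`, `i ∈ ℤ`, of uniform random variables on `[0, 1]`. -/
noncomputable def iidUniform : Measure (ℤ → unitInterval) :=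
  Measure.infinitePi fun _ : ℤ => (volume : Measure unitInterval)

/-- The process `1[X i = 1]` (the color `1` is `0 : Fin 4`) is equal in law to the process
`1[B i > B (i+1)]`, where `B` is an i.i.d. sequence of fair bits. -/
def HasFairDescentMarginal {Ω : Type*} [MeasurableSpace Ω]
    (X : ℤ → Ω → Fin 4) (P : Measure Ω) : Prop :=
  IdentDistrib (fun ω (i : ℤ) => ind (X i ω = 0))
    (fun (B : ℤ → Fin 2) (i : ℤ) => ind (B i > B (i + 1))) P fairBits

/-- The process `1[X i ∈ {1, 2}]` (the colors `1, 2` are `0, 1 : Fin 4`) is equal in law to the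
process `1[U i > U (i+1)]`, where `U` is i.i.d. uniform on `[0, 1]`. -/
def HasUniformDescentMarginal {Ω : Type*} [MeasurableSpace Ω]
    (X : ℤ → Ω → Fin 4) (P : Measure Ω) : Prop :=
  IdentDistrib (fun ω (i : ℤ) => ind (X i ω = 0 ∨ X i ω = 1))
    (fun (U : ℤ → unitInterval) (i : ℤ) => ind (U i > U (i + 1))) P iidUniform

/-- The process `1[Y i = 1]` (the color `1` is `0 : Fin 3`) is equal in law to the process
`1[U (i-1) < U i > U (i+1)]`, where `U` is i.i.d. uniform on `[0, 1]`. -/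
def HasUniformPeakMarginal {Ω : Type*} [MeasurableSpace Ω]
    (Y : ℤ → Ω → Fin 3) (P : Measure Ω) : Prop :=
  IdentDistrib (fun ω (i : ℤ) => ind (Y i ω = 0))
    (fun (U : ℤ → unitInterval) (i : ℤ) => ind (U (i - 1) < U i ∧ U i > U (i + 1)))
    P iidUniform

/-- For every `n`, the law of `(Y 1, …, Y n)` is the conditional law of `(X 1, …, X n)` given that
`X i ≠ 4` for `i = 1, …, n`. The color `4` is `3 : Fin 4`, and the colors `1, 2, 3` of `Y` are
regarded as colors of `X` through `Fin.castSucc`. The index `i : Fin n` stands for the position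
`i + 1 ∈ {1, …, n}`. The conditioning event has positive probability: otherwise the conditional
measure would be zero, while the law of `(Y 1, …, Y n)` is a probability measure. -/
def IsConditionedOnAvoidingLast {Ω Ω' : Type*} [MeasurableSpace Ω] [MeasurableSpace Ω']
    (Y : ℤ → Ω' → Fin 3) (P' : Measure Ω') (X : ℤ → Ω → Fin 4) (P : Measure Ω) : Prop :=
  ∀ n : ℕ, IdentDistrib
    (fun ω (i : Fin n) => (Y ((i : ℤ) + 1) ω).castSucc)
    (fun ω (i : Fin n) => X ((i : ℤ) + 1) ω)
    P' (cond P {ω | ∀ i : Fin n, X ((i : ℤ) + 1) ω ≠ 3})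

/-! Count the ways B(w) to build a word w by inserting letters one at a time, keeping adjacent
letters distinct at every stage, and give w a probability proportional to B(w) among words of its
length. B satisfies B(w) = Σ B(w with one letter deleted) for proper w, and B(w) = 0 otherwise.

The heart is the factorization of sums over a gap: with 4 colors, Σ_a B(x a y) = 2 C(|x|+|y|+2,
|x|+1) B(x) B(y), and with 3 colors there is an analogue for a gap of two letters. Expand by
deletions. Deletions inside x and y combine by induction and Pascal's rule, and what remains, the
deletion of gap letters with corrections for forbidden coincidences, sums to zero exactly for these
values of q. After normalization this is 1-dependence, respectively 2-dependence
(`sum_colorProb_four`, `sum_colorProb_three`). Summing over an end letter gives consistency, so a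
compactness argument produces the processes. Reversal and color symmetry are inherited from B, and
(v) holds because B does not see the size of the alphabet.

The marginals are identified from few probabilities. A 1-dependent 0-1 process is determined by its
runs of ones (`wordEvent_eq_of_run_eq`), and a 2-dependent one without adjacent ones by its runs of
zeros (`wordEvent_eq_of_zero_run_eq`). For (iii) and (iv) the runs are intervals colored with two
colors, hence alternating words, with B = 2^(n-1) at length n ≥ 1. They are compared with decreasing
sequences and with sequences without peaks.

For (ii), a stationary 1-dependent process without adjacent ones has density at most 1/4
(`IsWordDependent.density_le`). Four color densities summing to 1 must all equal 1/4, and then every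
run probability is known, whatever the coloring. -/

/-! ### Building numbers and their deletion recursion -/

section BuildingNumber

/-- The sum of `f` over the words obtained from a word by deleting one letter. -/
def deletionSum {α : Type*} (f : List α → ℝ) : List α → ℝ
  | [] => 0
  | c :: w => f w + deletionSum (fun v => f (c :: v)) w

variable {α : Type*}

lemma deletionSum_congr {f g : List α → ℝ} {w : List α}
    (h : ∀ v : List α, v.length + 1 = w.length → f v = g v) :
    deletionSum f w = deletionSum g w := by
  induction w generalizing f g with
  | nil => rfl
  | cons c w ih =>
    simp only [deletionSum]
    rw [h w (by simp), ih (f := fun v => f (c :: v)) (g := fun v => g (c :: v))]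
    intro v hv
    exact h _ (by simp [hv])

lemma deletionSum_append (f : List α → ℝ) (u v : List α) :
    deletionSum f (u ++ v) =
      deletionSum (fun s => f (s ++ v)) u + deletionSum (fun s => f (u ++ s)) v := by
  induction u generalizing f with
  | nil => simp [deletionSum]
  | cons c u ih => simp [deletionSum, ih, add_assoc]

lemma deletionSum_sum {ι : Type*} (s : Finset ι) (f : ι → List α → ℝ) (w : List α) :
    deletionSum (fun v => ∑ i ∈ s, f i v) w = ∑ i ∈ s, deletionSum (f i) w := by
  induction w generalizing f with
  | nil => simp [deletionSum]
  | cons c w ih => simp [deletionSum, ih, Finset.sum_add_distrib]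

lemma deletionSum_const_mul (r : ℝ) (f : List α → ℝ) (w : List α) :
    deletionSum (fun v => r * f v) w = r * deletionSum f w := by
  induction w generalizing f with
  | nil => simp [deletionSum]
  | cons c w ih => simp [deletionSum, ih, mul_add]

lemma deletionSum_eq_zero {f : List α → ℝ} {w : List α} (h : ∀ v, f v = 0) :
    deletionSum f w = 0 := by
  induction w generalizing f with
  | nil => rfl
  | cons c w ih => simp only [deletionSum]; rw [h, ih (fun v => h _), add_zero]

lemma deletionSum_nonneg {f : List α → ℝ} {w : List α} (h : ∀ v, 0 ≤ f v) :
    0 ≤ deletionSum f w := by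
  induction w generalizing f with
  | nil => exact le_rfl
  | cons c w ih => exact add_nonneg (h _) (ih fun v => h _)

lemma deletionSum_map {β : Type*} (σ : α → β) (f : List β → ℝ) (w : List α) :
    deletionSum f (w.map σ) = deletionSum (fun v => f (v.map σ)) w := by
  induction w generalizing f with
  | nil => rfl
  | cons c w ih => simp [deletionSum, ih]

lemma deletionSum_reverse (f : List α → ℝ) (w : List α) :
    deletionSum f w.reverse = deletionSum (fun v => f v.reverse) w := by
  induction w generalizing f with
  | nil => rfl
  | cons c w ih =>
    simp [deletionSum, deletionSum_append, ih, add_comm]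

variable [DecidableEq α]

/-- The building number of a word of length `n`, by recursion on `n`. -/
def buildingAux : ℕ → List α → ℝ
  | 0, _ => 1
  | n + 1, w => if w.IsChain (· ≠ ·) then deletionSum (buildingAux n) w else 0

/-- The number of ways to build a word by successively inserting letters, such that adjacent
letters differ at every stage. -/
def building (w : List α) : ℝ := buildingAux w.length w

@[simp] lemma building_nil : building ([] : List α) = 1 := rfl

lemma building_of_not_isChain {w : List α} (h : ¬ w.IsChain (· ≠ ·)) : building w = 0 := by
  cases w with
  | nil => simp at h
  | cons c w => simp only [building, List.length_cons, buildingAux, if_neg h]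

lemma building_of_isChain {w : List α} (h : w.IsChain (· ≠ ·)) (hw : w ≠ []) :
    building w = deletionSum building w := by
  cases w with
  | nil => simp at hw
  | cons c w =>
    simp only [building, List.length_cons, buildingAux, if_pos h]
    apply deletionSum_congr
    intro v hv
    rw [show w.length = v.length by simpa using hv.symm]
    rfl

lemma building_append_cons_cons (u v : List α) (c : α) : building (u ++ c :: c :: v) = 0 := by
  apply building_of_not_isChain
  simp [List.isChain_append]

lemma building_cons_cons_self (v : List α) (c : α) : building (c :: c :: v) = 0 :=
  building_append_cons_cons [] v c

@[simp] lemma building_singleton (c : α) : building [c] = 1 := by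
  rw [building_of_isChain (by simp) (by simp)]
  simp [deletionSum]

lemma building_nonneg (w : List α) : 0 ≤ building w := by
  suffices ∀ n (w : List α), 0 ≤ buildingAux n w from this _ _
  intro n
  induction n with
  | zero => intro w; simp [buildingAux]
  | succ n ih =>
    intro w
    rw [buildingAux]
    split_ifs
    · exact deletionSum_nonneg ih
    · exact le_rfl

/-- Building only tests letters for equality. This gives color symmetry and also, through the
inclusion of 3 colors into 4, the conditioning property (v). -/
lemma building_map {β : Type*} [DecidableEq β] {σ : α → β} (hσ : Function.Injective σ)
    (w : List α) : building (w.map σ) = building w := by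
  suffices ∀ n (w : List α), buildingAux n (w.map σ) = buildingAux n w by
    simpa [building] using this _ _
  intro n
  induction n with
  | zero => intro w; simp [buildingAux]
  | succ n ih =>
    intro w
    simp only [buildingAux, deletionSum_map, ih, List.isChain_map, hσ.ne_iff]

lemma building_reverse (w : List α) : building w.reverse = building w := by
  suffices ∀ n (w : List α), buildingAux n w.reverse = buildingAux n w by
    simpa [building] using this _ _
  intro n
  induction n with
  | zero => intro w; simp [buildingAux]
  | succ n ih =>
    intro w
    have : (w.reverse.IsChain (· ≠ ·)) ↔ w.IsChain (· ≠ ·) := by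
      rw [List.isChain_reverse]
      simp only [ne_comm]
    simp only [buildingAux, deletionSum_reverse, ih, this]

/-- The deletion recursion extended to the improper case `a = d`: there deleting `a` or `d` gives
the same word, while the left side is 0, so that word has to be subtracted twice. -/
lemma building_cons (a d : α) {y : List α} (hy : (d :: y).IsChain (· ≠ ·)) :
    building (a :: d :: y) = deletionSum (fun v => building (a :: v)) (d :: y)
      + (1 - 2 * if a = d then 1 else 0) * building (d :: y) := by
  by_cases h : a = d
  · subst h
    simp only [deletionSum, building_cons_cons_self, if_true]
    rw [deletionSum_eq_zero (fun _ => rfl)]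
    ring
  · rw [building_of_isChain (by simpa [List.isChain_cons_cons, h] using hy) (by simp),
      deletionSum]
    simp [h, add_comm]

/-- Same correction on both sides of `a`: a coincidence with a neighbor is compensated by
subtracting twice the word without `a`. If `a = c = d`, every term vanishes. -/
lemma building_append_cons (a c d : α) {x y : List α} (hx : (x ++ [c]).IsChain (· ≠ ·))
    (hy : (d :: y).IsChain (· ≠ ·)) :
    building (x ++ [c] ++ a :: d :: y) =
      deletionSum (fun u => building (u ++ a :: d :: y)) (x ++ [c])
      + deletionSum (fun v => building (x ++ [c] ++ a :: v)) (d :: y)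
      + (1 - 2 * (if a = c then 1 else 0) - 2 * if a = d then 1 else 0) *
        building (x ++ [c] ++ d :: y) := by
  by_cases hc : a = c
  · subst hc
    have h1 (v) : building (x ++ [a] ++ a :: v) = 0 := by
      simpa using building_append_cons_cons x v a
    rw [h1, deletionSum_eq_zero h1, deletionSum_append]
    have h2 : deletionSum (fun s => building (s ++ [a] ++ a :: d :: y)) x = 0 :=
      deletionSum_eq_zero fun v => by
        simpa using building_append_cons_cons v (d :: y) a
    rw [h2]
    by_cases hd : a = d
    · subst hd
      simp [deletionSum, building_append_cons_cons]
    · simp [deletionSum, hd]; ring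
  · by_cases hd : a = d
    · subst hd
      have h1 (u) : building (u ++ a :: a :: y) = 0 := building_append_cons_cons u y a
      rw [h1, deletionSum_eq_zero h1]
      have h2 : deletionSum (fun s => building (x ++ [c] ++ a :: a :: s)) y = 0 :=
        deletionSum_eq_zero fun v => building_append_cons_cons _ _ _
      simp only [deletionSum, h2]
      simp [hc]
      ring
    · have hch : (x ++ [c] ++ a :: d :: y).IsChain (· ≠ ·) := by
        rw [List.isChain_append]
        refine ⟨hx, by simpa [List.isChain_cons_cons, hd] using hy, ?_⟩
        intro s hs t ht
        simp at hs ht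
        subst hs ht
        exact fun h => hc h.symm
      rw [building_of_isChain hch (by simp), deletionSum_append, deletionSum]
      simp only [hc, hd, if_false]
      ring

/-- The coincidence `a = b` must be corrected only once; it is charged to the deletion of `a`,
whence the asymmetry of the two coefficients. -/
lemma building_append_cons_cons_eq (a b c d : α) {x y : List α}
    (hx : (x ++ [c]).IsChain (· ≠ ·)) (hy : (d :: y).IsChain (· ≠ ·)) :
    building (x ++ [c] ++ a :: b :: d :: y) =
      deletionSum (fun u => building (u ++ a :: b :: d :: y)) (x ++ [c])
      + deletionSum (fun v => building (x ++ [c] ++ a :: b :: v)) (d :: y)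
      + (1 - 2 * (if a = c then 1 else 0) - 2 * if a = b then 1 else 0) *
        building (x ++ [c] ++ b :: d :: y)
      + (1 - 2 * if b = d then 1 else 0) * building (x ++ [c] ++ a :: d :: y) := by
  by_cases hb : b = d
  · subst hb
    have h1 (u) : building (u ++ b :: b :: y) = 0 := building_append_cons_cons u y b
    have h2 (u) : building (u ++ a :: b :: b :: y) = 0 := by
      simpa using h1 (u ++ [a])
    have h3 : deletionSum (fun v => building (x ++ [c] ++ a :: b :: v)) (b :: y) =
        building (x ++ [c] ++ a :: b :: y) := by
      rw [deletionSum, deletionSum_eq_zero, add_zero]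
      intro v
      simpa using building_append_cons_cons (x ++ [c] ++ [a]) v b
    rw [h1, h2, h3, deletionSum_eq_zero h2]
    simp
    ring
  · have := building_append_cons a c b hx (y := d :: y)
      (by simpa [List.isChain_cons_cons, hb] using hy)
    rw [this, deletionSum]
    simp [hb]
    ring

lemma building_append_of_not_isChain_left {x : List α} (hx : ¬ x.IsChain (· ≠ ·)) (y : List α) :
    building (x ++ y) = 0 := by
  apply building_of_not_isChain
  rw [List.isChain_append]
  tauto

lemma building_append_of_not_isChain_right {y : List α} (hy : ¬ y.IsChain (· ≠ ·)) (x : List α) :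
    building (x ++ y) = 0 := by
  apply building_of_not_isChain
  rw [List.isChain_append]
  tauto

/-! ### Summing building numbers over inserted letters -/

variable [Fintype α]

lemma sum_building_cons (y : List α) :
    ∑ a, building (a :: y) =
      ((y.length + 1 : ℝ) * (Fintype.card α - 2) + 2) * building y := by
  induction hn : y.length using Nat.strong_induction_on generalizing y with
  | _ n ih =>
    cases y with
    | nil => simp at hn; subst hn; simp
    | cons d y =>
      by_cases hy : (d :: y).IsChain (· ≠ ·)
      · simp only [building_cons _ d hy, Finset.sum_add_distrib, ← Finset.sum_mul,
          Finset.sum_sub_distrib, ← Finset.mul_sum, ← deletionSum_sum]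
        have : deletionSum (fun v => ∑ a, building (a :: v)) (d :: y) =
            ((n : ℝ) * (Fintype.card α - 2) + 2) * building (d :: y) := by
          rw [building_of_isChain hy (by simp), ← deletionSum_const_mul]
          apply deletionSum_congr
          intro v hv
          rw [ih v.length (by omega) v rfl]
          rw [← hn, ← hv]
          push_cast
          ring
        rw [this]
        simp
        ring
      · rw [building_of_not_isChain hy, mul_zero]
        apply Finset.sum_eq_zero
        intro a _
        apply building_of_not_isChain
        intro h
        exact hy h.tail

lemma sum_building_append_singleton (y : List α) :
    ∑ a, building (y ++ [a]) =
      ((y.length + 1 : ℝ) * (Fintype.card α - 2) + 2) * building y := by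
  have := sum_building_cons y.reverse
  simp only [building_reverse, List.length_reverse] at this
  rw [← this]
  refine Finset.sum_congr rfl fun a _ => ?_
  rw [← building_reverse]
  simp

/-- Induction on total length; an empty side reduces to insertion at an end. -/
lemma sum_building_append_cons (hq : Fintype.card α = 4) (x y : List α) :
    ∑ a, building (x ++ a :: y) =
      2 * (Nat.choose (x.length + y.length + 2) (x.length + 1) : ℝ) *
        (building x * building y) := by
  induction hn : x.length + y.length using Nat.strong_induction_on generalizing x y with
  | _ n ih =>
    rcases List.eq_nil_or_concat' x with rfl | ⟨x, c, rfl⟩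
    · simp only [List.nil_append, sum_building_cons, hq]
      simp at hn
      simp only [hn, List.length_nil, zero_add, building_nil, one_mul, Nat.choose_one_right]
      push_cast
      ring
    rcases y with _ | ⟨d, y⟩
    · rw [sum_building_append_singleton, hq, ← hn]
      simp only [List.length_append, List.length_singleton, List.length_nil, add_zero,
        building_nil, mul_one]
      rw [Nat.choose_succ_self_right]
      push_cast
      ring
    by_cases hx : (x ++ [c]).IsChain (· ≠ ·)
    swap
    · simp only [building_of_not_isChain hx, building_append_of_not_isChain_left hx]
      simp
    by_cases hy : (d :: y).IsChain (· ≠ ·)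
    swap
    · rw [building_of_not_isChain hy, mul_zero, mul_zero]
      apply Finset.sum_eq_zero
      intro a _
      simpa using building_append_of_not_isChain_right hy (x ++ [c] ++ [a])
    simp only [building_append_cons _ c d hx hy, Finset.sum_add_distrib, ← Finset.sum_mul,
      Finset.sum_sub_distrib, ← Finset.mul_sum, ← deletionSum_sum]
    obtain ⟨m, hm⟩ : ∃ m, (x ++ [c]).length = m + 1 := ⟨x.length, by simp⟩
    obtain ⟨k, hk⟩ : ∃ k, (d :: y).length = k + 1 := ⟨y.length, by simp⟩
    rw [hm, hk] at hn
    have h1 : deletionSum (fun u => ∑ a, building (u ++ a :: d :: y)) (x ++ [c]) =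
        2 * (Nat.choose (n + 1) (m + 1) : ℝ) * (building (x ++ [c]) * building (d :: y)) := by
      rw [building_of_isChain hx (by simp), mul_comm (deletionSum _ _), ← mul_assoc,
        ← deletionSum_const_mul]
      apply deletionSum_congr
      intro v hv
      have hv' : v.length = m := by omega
      rw [ih (v.length + (d :: y).length) (by omega) v _ rfl, hk, hv',
        show m + (k + 1) + 2 = n + 1 by omega]
      ring
    have h2 : deletionSum (fun v => ∑ a, building (x ++ [c] ++ a :: v)) (d :: y) =
        2 * (Nat.choose (n + 1) (m + 2) : ℝ) * (building (x ++ [c]) * building (d :: y)) := by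
      rw [building_of_isChain hy (by simp), ← mul_assoc, ← deletionSum_const_mul]
      apply deletionSum_congr
      intro v hv
      have hv' : v.length = k := by omega
      rw [ih ((x ++ [c]).length + v.length) (by omega) _ v rfl, hm, hv',
        show m + 1 + k + 2 = n + 1 by omega]
      ring
    -- Pascal's rule joins the two deletion sums, and the correction coefficient sums over `a` to 4
    -- - 2 - 2 = 0.
    rw [h1, h2, hm, Nat.choose_succ_succ' (n + 1) (m + 1)]
    simp [hq]
    ring

lemma sum_sum_building_append_cons_cons (hq : Fintype.card α = 3) (x y : List α) :
    ∑ a, ∑ b, building (x ++ a :: b :: y) =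
      2 * (Nat.choose (x.length + y.length + 4) (x.length + 2) : ℝ) *
        (building x * building y) := by
  induction hn : x.length + y.length using Nat.strong_induction_on generalizing x y with
  | _ n ih =>
    rcases List.eq_nil_or_concat' x with rfl | ⟨x, c, rfl⟩
    · rw [Finset.sum_comm]
      simp only [List.nil_append, sum_building_cons, hq, List.length_cons, ← Finset.mul_sum]
      simp at hn
      simp [hn, Nat.cast_choose_two]
      ring
    rcases y with _ | ⟨d, y⟩
    · have (a b : α) : x ++ [c] ++ [a, b] = x ++ [c] ++ [a] ++ [b] := by simp
      simp only [this, sum_building_append_singleton, hq, List.length_append,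
        List.length_singleton, ← Finset.mul_sum, ← hn, List.length_nil, building_nil, add_zero]
      rw [← Nat.choose_symm (by omega),
        show x.length + 1 + 4 - (x.length + 1 + 2) = 2 by omega, Nat.cast_choose_two]
      push_cast
      ring
    by_cases hx : (x ++ [c]).IsChain (· ≠ ·)
    swap
    · simp only [building_of_not_isChain hx, building_append_of_not_isChain_left hx]
      simp
    by_cases hy : (d :: y).IsChain (· ≠ ·)
    swap
    · rw [building_of_not_isChain hy, mul_zero, mul_zero]
      refine Finset.sum_eq_zero fun a _ => Finset.sum_eq_zero fun b _ => ?_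
      simpa using building_append_of_not_isChain_right hy (x ++ [c] ++ [a] ++ [b])
    simp only [building_append_cons_cons_eq _ _ c d hx hy, Finset.sum_add_distrib,
      ← deletionSum_sum]
    obtain ⟨m, hm⟩ : ∃ m, (x ++ [c]).length = m + 1 := ⟨x.length, by simp⟩
    obtain ⟨k, hk⟩ : ∃ k, (d :: y).length = k + 1 := ⟨y.length, by simp⟩
    rw [hm, hk] at hn
    have h1 : deletionSum (fun u => ∑ a, ∑ b, building (u ++ a :: b :: d :: y)) (x ++ [c]) =
        2 * (Nat.choose (n + 3) (m + 2) : ℝ) * (building (x ++ [c]) * building (d :: y)) := by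
      rw [building_of_isChain hx (by simp), mul_comm (deletionSum _ _), ← mul_assoc,
        ← deletionSum_const_mul]
      apply deletionSum_congr
      intro v hv
      have hv' : v.length = m := by omega
      rw [ih (v.length + (d :: y).length) (by omega) v _ rfl, hk, hv',
        show m + (k + 1) + 4 = n + 3 by omega]
      ring
    have h2 : deletionSum (fun v => ∑ a, ∑ b, building (x ++ [c] ++ a :: b :: v)) (d :: y) =
        2 * (Nat.choose (n + 3) (m + 3) : ℝ) * (building (x ++ [c]) * building (d :: y)) := by
      rw [building_of_isChain hy (by simp), ← mul_assoc, ← deletionSum_const_mul]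
      apply deletionSum_congr
      intro v hv
      have hv' : v.length = k := by omega
      rw [ih ((x ++ [c]).length + v.length) (by omega) _ v rfl, hm, hv',
        show m + 1 + k + 4 = n + 3 by omega]
      ring
    rw [h1, h2, hm, Nat.choose_succ_succ' (n + 3) (m + 2)]
    -- With three letters the coefficients sum to 3 - 2 - 2 = -1 here and to 3 - 2 = 1 in `h4`, so
    -- the corrections cancel.
    have h3 : ∑ a, ∑ b, (1 - 2 * (if a = c then 1 else 0) - 2 * if a = b then 1 else 0) *
        building (x ++ [c] ++ b :: d :: y) = -∑ b, building (x ++ [c] ++ b :: d :: y) := by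
      rw [Finset.sum_comm, ← Finset.sum_neg_distrib]
      refine Finset.sum_congr rfl fun b _ => ?_
      rw [← Finset.sum_mul, Finset.sum_sub_distrib, Finset.sum_sub_distrib, ← Finset.mul_sum,
        ← Finset.mul_sum]
      simp [hq]
      ring
    have h4 : ∑ a, ∑ b, (1 - 2 * if b = d then 1 else 0) *
        building (x ++ [c] ++ a :: d :: y) = ∑ b, building (x ++ [c] ++ b :: d :: y) := by
      refine Finset.sum_congr rfl fun b _ => ?_
      rw [← Finset.sum_mul, Finset.sum_sub_distrib, ← Finset.mul_sum]
      simp [hq]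
      ring
    rw [h3, h4]
    push_cast
    ring

end BuildingNumber

/-! ### Alternating words -/

section Alternating

/-- The word `c d c d …` of length `n`. -/
def alternating {α : Type*} (c d : α) : ℕ → List α
  | 0 => []
  | n + 1 => c :: alternating d c n

variable {α : Type*}

@[simp] lemma length_alternating (c d : α) (n : ℕ) : (alternating c d n).length = n := by
  induction n generalizing c d with
  | zero => rfl
  | succ n ih => simp [alternating, ih]

lemma isChain_alternating {c d : α} (h : c ≠ d) (n : ℕ) :
    (alternating c d n).IsChain (· ≠ ·) := by
  induction n generalizing c d with
  | zero => simp [alternating]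
  | succ n ih =>
    cases n with
    | zero => simp [alternating]
    | succ n =>
      have := ih h.symm
      rw [alternating] at this
      simp only [alternating, List.isChain_cons_cons]
      exact ⟨h, this⟩

variable [DecidableEq α]

/-- Deleting any letter but the last puts two equal letters side by side, so one term survives.
Hence an alternating word of length at least two can only lose an end letter, and its building
number doubles with each letter. -/
lemma deletionSum_building_alternating (u : List α) (c d : α) (n : ℕ) :
    deletionSum (fun v => building (u ++ d :: v)) (alternating c d (n + 1)) =
      building (u ++ d :: alternating c d n) := by
  induction n generalizing u c d with
  | zero => simp [alternating, deletionSum]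
  | succ n ih =>
    have := ih (u ++ [d]) d c
    simp only [List.append_assoc, List.singleton_append] at this
    rw [alternating, deletionSum, this, alternating, building_append_cons_cons, zero_add]
    rfl

lemma building_alternating {c d : α} (h : c ≠ d) (n : ℕ) :
    building (alternating c d (n + 1)) = 2 ^ n := by
  induction n generalizing c d with
  | zero => simp [alternating]
  | succ n ih =>
    rw [building_of_isChain (isChain_alternating h _) (by simp [alternating]), alternating,
      deletionSum, ih h.symm]
    have := deletionSum_building_alternating [] d c n
    simp only [List.nil_append] at this
    rw [this, ← alternating, ih h]
    ring

end Alternating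

/-! ### Normalized word probabilities -/

section ColorProb

/-- The sum of the building numbers of all words of length `n` over `q` letters. -/
noncomputable def buildingTotal (q n : ℕ) : ℝ :=
  ∏ k ∈ Finset.range n, ((k + 1 : ℝ) * (q - 2) + 2)

lemma buildingTotal_succ (q n : ℕ) :
    buildingTotal q (n + 1) = buildingTotal q n * ((n + 1 : ℝ) * (q - 2) + 2) :=
  Finset.prod_range_succ _ _

lemma buildingTotal_pos {q : ℕ} (hq : 2 ≤ q) (n : ℕ) : 0 < buildingTotal q n := by
  apply Finset.prod_pos
  intro k _
  have : (2 : ℝ) ≤ q := by exact_mod_cast hq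
  have : 0 ≤ (k + 1 : ℝ) * (q - 2) := mul_nonneg (by positivity) (by linarith)
  linarith

lemma buildingTotal_four (n : ℕ) : buildingTotal 4 n = 2 ^ n * (n + 1).factorial := by
  induction n with
  | zero => simp [buildingTotal]
  | succ n ih =>
    rw [buildingTotal_succ, ih, Nat.factorial_succ (n + 1)]
    push_cast
    ring

lemma buildingTotal_three (n : ℕ) : buildingTotal 3 n = (n + 2).factorial / 2 := by
  induction n with
  | zero => simp [buildingTotal]
  | succ n ih =>
    rw [buildingTotal_succ, ih, Nat.factorial_succ (n + 2)]
    push_cast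
    ring

/-- The probability of the word `w` under the coloring with `q` colors. -/
noncomputable def colorProb (q : ℕ) (w : List (Fin q)) : ℝ :=
  building w / buildingTotal q w.length

variable {q : ℕ}

@[simp] lemma colorProb_nil : colorProb q [] = 1 := by
  simp [colorProb, buildingTotal]

lemma colorProb_nonneg (hq : 2 ≤ q) (w : List (Fin q)) : 0 ≤ colorProb q w :=
  div_nonneg (building_nonneg w) (buildingTotal_pos hq _).le

lemma colorProb_reverse (w : List (Fin q)) : colorProb q w.reverse = colorProb q w := by
  simp [colorProb, building_reverse]

lemma colorProb_map {σ : Fin q → Fin q} (hσ : Function.Injective σ) (w : List (Fin q)) :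
    colorProb q (w.map σ) = colorProb q w := by
  simp [colorProb, building_map hσ]

lemma colorProb_pair_self (c : Fin q) : colorProb q [c, c] = 0 := by
  simp [colorProb, building_cons_cons_self]

lemma colorProb_alternating {c d : Fin q} (h : c ≠ d) (n : ℕ) :
    colorProb q (alternating c d (n + 1)) = 2 ^ n / buildingTotal q (n + 1) := by
  simp [colorProb, building_alternating h]

lemma sum_colorProb_cons (hq : 2 ≤ q) (w : List (Fin q)) :
    ∑ a, colorProb q (a :: w) = colorProb q w := by
  have := buildingTotal_pos hq w.length
  have h2 := buildingTotal_pos hq (w.length + 1)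
  rw [buildingTotal_succ] at h2
  have h3 := (pos_iff_pos_of_mul_pos h2).1 this
  simp only [colorProb, List.length_cons, ← Finset.sum_div, sum_building_cons,
    buildingTotal_succ, Fintype.card_fin]
  field_simp

lemma sum_colorProb_append_singleton (hq : 2 ≤ q) (w : List (Fin q)) :
    ∑ a, colorProb q (w ++ [a]) = colorProb q w := by
  rw [← colorProb_reverse w, ← sum_colorProb_cons hq]
  refine Finset.sum_congr rfl fun a _ => ?_
  rw [← colorProb_reverse]
  simp

/-- The total for length n is 2^n (n+1)!, whose factorials absorb the binomial coefficient exactly.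
-/
lemma sum_colorProb_four (x y : List (Fin 4)) :
    ∑ a, colorProb 4 (x ++ a :: y) = colorProb 4 x * colorProb 4 y := by
  have h (a) : (x ++ a :: y).length = x.length + y.length + 1 := by simp; ring
  simp only [colorProb, h, ← Finset.sum_div, sum_building_append_cons (Fintype.card_fin 4),
    buildingTotal_four]
  rw [Nat.cast_choose ℝ (by omega),
    show x.length + y.length + 2 - (x.length + 1) = y.length + 1 by omega]
  field_simp
  ring

lemma sum_colorProb_three (x y : List (Fin 3)) :
    ∑ a, ∑ b, colorProb 3 (x ++ a :: b :: y) = colorProb 3 x * colorProb 3 y := by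
  have h (a b) : (x ++ a :: b :: y).length = x.length + y.length + 2 := by simp; ring
  simp only [colorProb, h, ← Finset.sum_div,
    sum_sum_building_append_cons_cons (Fintype.card_fin 3), buildingTotal_three]
  rw [Nat.cast_choose ℝ (by omega),
    show x.length + y.length + 4 - (x.length + 2) = y.length + 2 by omega]
  field_simp

end ColorProb

/-! ### Cylinder events, laws and dependence -/

section Cylinder

variable {Ω S : Type*}

/-- The event that the process `X` spells the word `w` from position `a` on. -/
def wordEvent (X : ℤ → Ω → S) : ℤ → List S → Set Ω
  | _, [] => Set.univ
  | a, s :: w => {ω | X a ω = s} ∩ wordEvent X (a + 1) w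

lemma mem_wordEvent {X : ℤ → Ω → S} {a : ℤ} {w : List S} {ω : Ω} :
    ω ∈ wordEvent X a w ↔ ∀ (i : ℕ) (h : i < w.length), X (a + i) ω = w[i] := by
  induction w generalizing a with
  | nil => simp [wordEvent]
  | cons s w ih =>
    simp only [wordEvent, Set.mem_inter_iff, Set.mem_ofPred_eq, ih]
    constructor
    · rintro ⟨h0, h⟩ i hi
      cases i with
      | zero => simpa using h0
      | succ i =>
        have := h i (by simpa using hi)
        simp only [List.getElem_cons_succ, ← this]
        congr 1
        push_cast
        ring
    · intro h
      refine ⟨by simpa using! h 0 (by simp), fun i hi => ?_⟩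
      have := h (i + 1) (by simpa using hi)
      simp only [List.getElem_cons_succ] at this
      rw [← this]
      congr 1
      push_cast
      ring

lemma mem_wordEvent_ofFn {X : ℤ → Ω → S} {a : ℤ} {n : ℕ} {x : Fin n → S} {ω : Ω} :
    ω ∈ wordEvent X a (List.ofFn x) ↔ (fun i : Fin n => X (a + i) ω) = x := by
  rw [mem_wordEvent, funext_iff]
  constructor
  · intro h i
    simpa using h i (by simp)
  · intro h i hi
    simpa using h ⟨i, by simpa using hi⟩

lemma wordEvent_append (X : ℤ → Ω → S) (a : ℤ) (u v : List S) :
    wordEvent X a (u ++ v) = wordEvent X a u ∩ wordEvent X (a + u.length) v := by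
  induction u generalizing a with
  | nil => simp [wordEvent]
  | cons s u ih =>
    simp only [List.cons_append, wordEvent, ih, List.length_cons, Set.inter_assoc]
    rw [show a + 1 + (u.length : ℤ) = a + ((u.length + 1 : ℕ) : ℤ) by push_cast; ring]

lemma measurableSet_wordEvent {m : MeasurableSpace Ω} [MeasurableSpace S]
    [MeasurableSingletonClass S] {X : ℤ → Ω → S} {a : ℤ} {w : List S}
    (h : ∀ i : ℤ, a ≤ i → i < a + w.length → Measurable[m] (X i)) :
    MeasurableSet[m] (wordEvent X a w) := by
  induction w generalizing a with
  | nil => exact MeasurableSet.univ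
  | cons s w ih =>
    refine MeasurableSet.inter ?_ (ih fun i hi hi' => h i (by omega) ?_)
    · exact h a le_rfl (by simp) (measurableSet_singleton s)
    · simp; omega

variable [MeasurableSpace Ω] [MeasurableSpace S] [MeasurableSingletonClass S]

lemma measurableSet_wordEvent_of_measurable {X : ℤ → Ω → S} (hX : ∀ i, Measurable (X i))
    (a : ℤ) (w : List S) : MeasurableSet (wordEvent X a w) :=
  measurableSet_wordEvent fun i _ _ => hX i

lemma map_block_eq [Countable S] {Ω' : Type*} [MeasurableSpace Ω'] {X : ℤ → Ω → S}
    {X' : ℤ → Ω' → S} {P : Measure Ω} {P' : Measure Ω'} (hX : ∀ i, Measurable (X i))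
    (hX' : ∀ i, Measurable (X' i)) {a a' : ℤ} {n : ℕ}
    (h : ∀ w, P (wordEvent X a w) = P' (wordEvent X' a' w)) :
    P.map (fun ω (i : Fin n) => X (a + i) ω) = P'.map (fun ω (i : Fin n) => X' (a' + i) ω) := by
  refine Measure.ext_of_singleton fun x => ?_
  rw [Measure.map_apply (by fun_prop) (measurableSet_singleton x),
    Measure.map_apply (by fun_prop) (measurableSet_singleton x)]
  convert h (List.ofFn x) using 2
  · ext ω
    rw [mem_wordEvent_ofFn]
    rfl
  · ext ω
    rw [mem_wordEvent_ofFn]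
    rfl

/-- The law of a process is determined by the probabilities of words. -/
lemma identDistrib_of_wordEvent [Countable S] {Ω' : Type*} [MeasurableSpace Ω']
    {X : ℤ → Ω → S} {X' : ℤ → Ω' → S} {P : Measure Ω} {P' : Measure Ω'} [IsFiniteMeasure P]
    [IsFiniteMeasure P'] (hX : ∀ i, Measurable (X i)) (hX' : ∀ i, Measurable (X' i))
    (h : ∀ a w, P (wordEvent X a w) = P' (wordEvent X' a w)) :
    IdentDistrib (fun ω i => X i ω) (fun ω i => X' i ω) P P' := by
  refine ⟨by fun_prop, by fun_prop, ?_⟩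
  refine IsProjectiveLimit.unique (P := fun I => (P'.map fun ω i => X' i ω).map I.restrict)
    (fun I => ?_) fun I => rfl
  -- A finite marginal is a function of the block over any interval containing its indices.
  obtain ⟨a, n, hI⟩ : ∃ (a : ℤ) (n : ℕ), ∀ i ∈ I, a ≤ i ∧ i < a + n := by
    obtain ⟨c, hc⟩ := I.bddBelow
    obtain ⟨d, hd⟩ := I.bddAbove
    refine ⟨c, (d - c + 1).toNat, fun i hi => ⟨hc hi, ?_⟩⟩
    have := hd hi
    have := hc hi
    omega
  have key := map_block_eq hX hX' (n := n) (h a)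
  let g : (Fin n → S) → (I → S) := fun x i =>
    x ⟨(i.1 - a).toNat, by have := hI i.1 i.2; omega⟩
  have hg : Measurable g := by fun_prop
  have hcomp : g ∘ (fun (x : ℤ → S) (i : Fin n) => x (a + i)) = I.restrict := by
    ext x i
    simp only [Function.comp, Finset.restrict, g]
    congr 1
    have := hI i.1 i.2
    omega
  change _ = (P'.map fun ω i => X' i ω).map I.restrict
  have hblock : Measurable fun (x : ℤ → S) (i : Fin n) => x (a + i) := by fun_prop
  have hXm : Measurable fun ω i => X i ω := by fun_prop
  have hXm' : Measurable fun ω i => X' i ω := by fun_prop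
  rw [← hcomp, ← Measure.map_map hg hblock, ← Measure.map_map hg hblock,
    Measure.map_map hblock hXm, Measure.map_map hblock hXm']
  exact congrArg (Measure.map g) key

/-- Words separated by `k` letters occur independently. -/
def IsWordDependent (k : ℕ) (X : ℤ → Ω → S) (P : Measure Ω) : Prop :=
  ∀ (a : ℤ) (u v : List S),
    P.real (wordEvent X a u ∩ wordEvent X (a + u.length + k) v) =
      P.real (wordEvent X a u) * P.real (wordEvent X (a + u.length + k) v)

omit [MeasurableSingletonClass S] in
lemma IsDependent.isWordDependent_comp {T : Type*} [MeasurableSpace T]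
    [MeasurableSingletonClass T] {k : ℕ} {X : ℤ → Ω → S} {P : Measure Ω}
    (h : IsDependent k X P) {f : S → T} (hf : Measurable f) :
    IsWordDependent k (fun i ω => f (X i ω)) P := by
  intro a u v
  have := (IndepFun_iff _ _ _).1 (h (a + u.length)) _ _
    (measurableSet_wordEvent (X := fun i ω => f (X i ω)) (a := a) (w := u) ?_)
    (measurableSet_wordEvent (X := fun i ω => f (X i ω)) (a := a + u.length + k) (w := v) ?_)
  · simp only [measureReal_def, this, ENNReal.toReal_mul]
  · intro i _ hi
    have : Measurable fun x : Set.Iio (a + u.length : ℤ) → S => x ⟨i, hi⟩ := measurable_pi_apply _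
    exact hf.comp (this.comp (comap_measurable _))
  · intro i hi _
    have : Measurable fun x : Set.Ici (a + u.length + k : ℤ) → S => x ⟨i, hi⟩ :=
      measurable_pi_apply _
    exact hf.comp (this.comp (comap_measurable _))

omit [MeasurableSpace Ω] [MeasurableSingletonClass S] in
lemma comap_pi_le {ι : Type*} {m : MeasurableSpace Ω} {f : Ω → ι → S}
    (h : ∀ j, Measurable[m] fun ω => f ω j) : MeasurableSpace.comap f MeasurableSpace.pi ≤ m :=
  (measurable_pi_lambda _ h).comap_le

/-- Finite blocks ending at i - 1 and starting at i + k are independent by checking atoms; the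
half-line σ-algebras are increasing unions of block σ-algebras. -/
lemma IsWordDependent.isDependent [Countable S] {k : ℕ} {X : ℤ → Ω → S} {P : Measure Ω}
    [IsProbabilityMeasure P] (hX : ∀ i, Measurable (X i)) (h : IsWordDependent k X P) :
    IsDependent k X P := by
  intro i
  let past (m : ℕ) (ω : Ω) (j : Fin m) : S := X (i - m + j) ω
  let fut (n : ℕ) (ω : Ω) (j : Fin n) : S := X (i + k + j) ω
  have hpm (m) : Measurable (past m) := by fun_prop
  have hfm (n) : Measurable (fut n) := by fun_prop
  have hind (m n) : IndepFun (past m) (fut n) P := by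
    rw [indepFun_iff_map_prod_eq_prod_map_map (hpm m).aemeasurable (hfm n).aemeasurable]
    refine Measure.ext_of_singleton fun ⟨x, y⟩ => ?_
    have hp : past m ⁻¹' {x} = wordEvent X (i - m) (List.ofFn x) := by
      ext ω
      rw [mem_wordEvent_ofFn]
      rfl
    have hf : fut n ⁻¹' {y} =
        wordEvent X (i - m + (List.ofFn x).length + k) (List.ofFn y) := by
      ext ω
      rw [mem_wordEvent_ofFn]
      simp only [List.length_ofFn, sub_add_cancel]
      rfl
    rw [← Set.singleton_prod_singleton, Measure.prod_prod,
      Measure.map_apply (by fun_prop) (by measurability),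
      Measure.map_apply (hpm m) (measurableSet_singleton x),
      Measure.map_apply (hfm n) (measurableSet_singleton y)]
    have := h (i - m) (List.ofFn x) (List.ofFn y)
    rw [← hp, ← hf, measureReal_def, measureReal_def, measureReal_def, ← ENNReal.toReal_mul,
      ENNReal.toReal_eq_toReal_iff' (by finiteness) (by finiteness)] at this
    exact this
  have hpmono : Monotone fun m => MeasurableSpace.comap (past m) inferInstance := by
    intro m m' hmm
    refine comap_pi_le fun j => ?_
    have : Measurable fun x : Fin m' → S => x ⟨m' - m + j, by omega⟩ := measurable_pi_apply _
    convert this.comp (comap_measurable (past m')) using 1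
    ext ω
    simp only [past, Function.comp]
    congr 1
    push_cast [Nat.cast_sub hmm]
    ring
  have hfmono : Monotone fun n => MeasurableSpace.comap (fut n) inferInstance := by
    intro n n' hnn
    refine comap_pi_le fun j => ?_
    have : Measurable fun x : Fin n' → S => x ⟨j, by omega⟩ := measurable_pi_apply _
    exact this.comp (comap_measurable (fut n'))
  -- Pass to the limit in the past with the future block fixed, then in the future.
  have h1 (n) : Indep (⨆ m, MeasurableSpace.comap (past m) inferInstance)
      (MeasurableSpace.comap (fut n) inferInstance) P :=
    indep_iSup_of_monotone (fun m => (IndepFun_iff_Indep _ _ _).1 (hind m n))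
      (fun m => (hpm m).comap_le) (hfm n).comap_le hpmono
  have h2 := indep_iSup_of_monotone (fun n => (h1 n).symm)
      (fun n => (hfm n).comap_le) (iSup_le fun m => (hpm m).comap_le) hfmono
  rw [IndepFun_iff_Indep]
  refine indep_of_indep_of_le_left (indep_of_indep_of_le_right h2.symm ?_) ?_
  · refine comap_pi_le fun j => ?_
    refine Measurable.mono ?_ (le_iSup _ (j.1 - (i + k) + 1).toNat) le_rfl
    have hj : i + k ≤ j.1 := j.2
    have : Measurable fun x : Fin (j.1 - (i + k) + 1).toNat → S =>
      x ⟨(j.1 - (i + k)).toNat, by omega⟩ := measurable_pi_apply _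
    convert this.comp (comap_measurable (fut _)) using 1
    ext ω
    simp only [fut, Function.comp]
    congr 1
    omega
  · refine comap_pi_le fun j => ?_
    refine Measurable.mono ?_ (le_iSup _ (i - j.1).toNat) le_rfl
    have hj : j.1 < i := j.2
    have : Measurable fun x : Fin (i - j.1).toNat → S => x ⟨0, by omega⟩ := measurable_pi_apply _
    convert this.comp (comap_measurable (past _)) using 1
    ext ω
    simp only [past, Function.comp]
    congr 1
    push_cast
    omega

end Cylinder

/-! ### 0-1 processes determined by their runs -/

section BoolProcess

variable {Ω Ω' : Type*} [MeasurableSpace Ω] [MeasurableSpace Ω'] {J : ℤ → Ω → Bool}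
  {J' : ℤ → Ω' → Bool} {P : Measure Ω} {P' : Measure Ω'}

/-- Summing over the letter between two words. -/
lemma measureReal_wordEvent_true_add_false [IsFiniteMeasure P] (hJ : ∀ i, Measurable (J i))
    (a : ℤ) (u v : List Bool) :
    P.real (wordEvent J a (u ++ true :: v)) + P.real (wordEvent J a (u ++ false :: v)) =
      P.real (wordEvent J a u ∩ wordEvent J (a + u.length + 1) v) := by
  rw [← measureReal_union]
  · congr 1
    ext ω
    simp only [wordEvent_append, wordEvent, Set.mem_union, Set.mem_inter_iff, Set.mem_ofPred_eq]
    cases J (a + u.length) ω <;> simp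
  · rw [Set.disjoint_left]
    intro ω h1 h2
    simp only [wordEvent_append, wordEvent, Set.mem_inter_iff, Set.mem_ofPred_eq] at h1 h2
    simp [h1.2.1] at h2
  · exact measurableSet_wordEvent_of_measurable hJ _ _

lemma IsWordDependent.true_add_false [IsFiniteMeasure P] (hJ : ∀ i, Measurable (J i))
    (h : IsWordDependent 1 J P) (a : ℤ) (u v : List Bool) :
    P.real (wordEvent J a (u ++ true :: v)) + P.real (wordEvent J a (u ++ false :: v)) =
      P.real (wordEvent J a u) * P.real (wordEvent J (a + u.length + 1) v) := by
  rw [measureReal_wordEvent_true_add_false hJ]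
  exact h a u v

lemma exists_eq_replicate_append (b : Bool) (w : List Bool) :
    (w = List.replicate w.length b) ∨
      ∃ n t, w = List.replicate n b ++ (!b) :: t := by
  induction w with
  | nil => simp
  | cons c w ih =>
    by_cases hc : c = b
    · subst hc
      rcases ih with h | ⟨n, t, h⟩
      · left
        rw [List.length_cons, List.replicate_succ, ← h]
      · right
        exact ⟨n + 1, t, by rw [List.replicate_succ, List.cons_append, ← h]⟩
    · right
      refine ⟨0, w, ?_⟩
      cases c <;> cases b <;> simp_all

/-- A `1`-dependent `0`-`1` process is determined by the probabilities of runs of ones. -/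
lemma wordEvent_eq_of_run_eq [IsFiniteMeasure P] [IsFiniteMeasure P']
    (hJ : ∀ i, Measurable (J i)) (hJ' : ∀ i, Measurable (J' i)) (h : IsWordDependent 1 J P)
    (h' : IsWordDependent 1 J' P')
    (hrun : ∀ a n, P.real (wordEvent J a (List.replicate n true)) =
      P'.real (wordEvent J' a (List.replicate n true))) (w : List Bool) :
    ∀ a, P.real (wordEvent J a w) = P'.real (wordEvent J' a w) := by
  induction hn : w.length using Nat.strong_induction_on generalizing w with
  | _ n ih =>
  -- Turning the first zero into a one lowers the number of zeros at equal length, and the product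
  -- term involves a run of ones and a shorter word.
  induction hc : w.count false using Nat.strong_induction_on generalizing w with
  | _ c ih2 =>
  intro a
  rcases exists_eq_replicate_append true w with hw | ⟨m, t, hw⟩
  · rw [hw]
    exact hrun a _
  · rw [Bool.not_true] at hw
    have e := h.true_add_false hJ a (List.replicate m true) t
    have e' := h'.true_add_false hJ' a (List.replicate m true) t
    have hl : (List.replicate m true ++ true :: t).length = n := by rw [← hn, hw]; simp
    have hcount : (List.replicate m true ++ true :: t).count false < c := by
      rw [← hc, hw]
      simp [List.count_append, List.count_replicate]
    rw [ih2 _ hcount _ hl rfl a, hrun, ih t.length (by simp at hl; omega) t rfl] at e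
    rw [hw]
    linarith

/-- Sum over the four fillings of a gap of two sites; the filling by two ones is null. -/
lemma IsWordDependent.sum_pairs [IsFiniteMeasure P] (hJ : ∀ i, Measurable (J i))
    (h : IsWordDependent 2 J P) (hhc : ∀ a, P.real (wordEvent J a [true, true]) = 0)
    (a : ℤ) (u v : List Bool) :
    P.real (wordEvent J a (u ++ false :: true :: v)) =
      P.real (wordEvent J a u) * P.real (wordEvent J (a + u.length + 2) v) -
      P.real (wordEvent J a (u ++ false :: false :: v)) -
      P.real (wordEvent J a (u ++ true :: false :: v)) := by
  have h0 : P.real (wordEvent J a (u ++ true :: true :: v)) = 0 := by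
    refine le_antisymm ?_ measureReal_nonneg
    rw [← hhc (a + u.length)]
    refine measureReal_mono (fun ω hω => ?_) (by finiteness)
    simp only [wordEvent_append, wordEvent, Set.mem_inter_iff] at hω ⊢
    tauto
  have e1 := measureReal_wordEvent_true_add_false (P := P) hJ a (u ++ [true]) v
  have e2 := measureReal_wordEvent_true_add_false (P := P) hJ a (u ++ [false]) v
  have e3 : P.real (wordEvent J a u ∩ wordEvent J (a + u.length + 2) v) =
      P.real (wordEvent J a (u ++ [true]) ∩
        wordEvent J (a + (u ++ [true]).length + 1) v) +
      P.real (wordEvent J a (u ++ [false]) ∩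
        wordEvent J (a + (u ++ [false]).length + 1) v) := by
    rw [← measureReal_union]
    · congr 1
      ext ω
      have (b : Bool) : a + ((u ++ [b]).length : ℤ) + 1 = a + u.length + 2 := by simp; ring
      rw [this, this]
      simp only [wordEvent_append, wordEvent, Set.mem_union, Set.mem_inter_iff,
        Set.mem_ofPred_eq]
      cases J (a + u.length) ω <;> simp
    · rw [Set.disjoint_left]
      intro ω h1 h2
      simp only [wordEvent_append, wordEvent, Set.mem_inter_iff, Set.mem_ofPred_eq] at h1 h2
      simp [h1.1.2.1] at h2
    · exact (measurableSet_wordEvent_of_measurable hJ _ _).inter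
        (measurableSet_wordEvent_of_measurable hJ _ _)
  have e4 := h a u v
  simp only [List.append_assoc, List.singleton_append] at e1 e2 e3
  push_cast at e4
  linarith

/-- A `2`-dependent `0`-`1` process without adjacent ones is determined by the probabilities of
runs of zeros. -/
lemma wordEvent_eq_of_zero_run_eq [IsFiniteMeasure P] [IsFiniteMeasure P']
    (hJ : ∀ i, Measurable (J i)) (hJ' : ∀ i, Measurable (J' i)) (h : IsWordDependent 2 J P)
    (h' : IsWordDependent 2 J' P') (hhc : ∀ a, P.real (wordEvent J a [true, true]) = 0)
    (hhc' : ∀ a, P'.real (wordEvent J' a [true, true]) = 0)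
    (hrun : ∀ a n, P.real (wordEvent J a (List.replicate n false)) =
      P'.real (wordEvent J' a (List.replicate n false))) (w : List Bool) :
    ∀ a, P.real (wordEvent J a w) = P'.real (wordEvent J' a w) := by
  induction hn : w.length using Nat.strong_induction_on generalizing w with
  | _ n ih =>
  induction hc : w.count true using Nat.strong_induction_on generalizing w with
  | _ c ih2 =>
  -- A third induction, on the number m of zeros before the first one. Resolving the pair 01 that
  -- ends this prefix leaves shorter words, a word with fewer ones, and one whose first one has
  -- moved a site to the left.
  suffices key : ∀ (m : ℕ) (t : List Bool),
      (List.replicate m false ++ true :: t).length = n →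
      (List.replicate m false ++ true :: t).count true = c →
      ∀ a, P.real (wordEvent J a (List.replicate m false ++ true :: t)) =
        P'.real (wordEvent J' a (List.replicate m false ++ true :: t)) by
    intro a
    rcases exists_eq_replicate_append false w with hw | ⟨m, t, hw⟩
    · rw [hw]
      exact hrun a _
    · rw [Bool.not_false] at hw
      rw [hw] at hn hc ⊢
      exact key m t hn hc a
  intro m
  induction m with
  | zero =>
    intro t ht htc a
    -- A leading one needs no dependence hypothesis: it is removed by summing over the first letter.
    have e := measureReal_wordEvent_true_add_false (P := P) hJ a [] t
    have e' := measureReal_wordEvent_true_add_false (P := P') hJ' a [] t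
    simp only [List.replicate_zero, List.nil_append, wordEvent, Set.univ_inter] at e e' ht htc ⊢
    have h1 := ih2 (List.count true (false :: t)) (by rw [← htc]; simp) (false :: t)
      (by rw [← ht]; simp) rfl a
    have h2 := ih t.length (by rw [← ht]; simp) t rfl (a + 1)
    simp only [wordEvent, List.length_nil, Nat.cast_zero, add_zero] at e e' h1 h2
    linarith
  | succ m ihm =>
    intro t ht htc a
    have hsplit (b : Bool) : List.replicate (m + 1) false ++ b :: t =
        List.replicate m false ++ false :: b :: t := by
      rw [List.replicate_succ']
      simp
    have e := h.sum_pairs hJ hhc a (List.replicate m false) t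
    have e' := h'.sum_pairs hJ' hhc' a (List.replicate m false) t
    have hl : m + 1 + 1 + t.length = n := by
      rw [← ht]
      simp
      ring
    have hcn : t.count true + 1 = c := by
      rw [← htc]
      simp [List.count_append, List.count_replicate]
    rw [hsplit, e, e', ih m (by omega) _ (by simp), ih t.length (by omega) t rfl,
      ih2 (t.count true) (by omega) (List.replicate m false ++ false :: false :: t)
        (by simp; omega) (by simp [List.count_append, List.count_replicate]),
      ihm (false :: t) (by simp; omega) (by simp [List.count_append, List.count_replicate]; omega)]

/-- Equality in law of `0`-`1` processes from equality of word probabilities. -/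
lemma identDistrib_ind [IsFiniteMeasure P] [IsFiniteMeasure P'] {A : ℤ → Ω → Prop}
    {A' : ℤ → Ω' → Prop} (hJ : ∀ i, Measurable (J i)) (hJ' : ∀ i, Measurable (J' i))
    (hA : ∀ i ω, J i ω = true ↔ A i ω) (hA' : ∀ i ω, J' i ω = true ↔ A' i ω)
    (h : ∀ w a, P.real (wordEvent J a w) = P'.real (wordEvent J' a w)) :
    IdentDistrib (fun ω i => ind (A i ω)) (fun ω i => ind (A' i ω)) P P' := by
  have h1 : IdentDistrib (fun ω i => J i ω) (fun ω i => J' i ω) P P' := by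
    refine identDistrib_of_wordEvent hJ hJ' fun a w => ?_
    have := h w a
    rwa [measureReal_def, measureReal_def,
      ENNReal.toReal_eq_toReal_iff' (by finiteness) (by finiteness)] at this
  have h2 := h1.comp (u := fun (x : ℤ → Bool) (i : ℤ) => bif x i then (1 : ℕ) else 0)
    (measurable_pi_iff.2 fun i =>
      Measurable.comp (g := fun b : Bool => bif b then (1 : ℕ) else 0)
        (measurable_of_countable _) (measurable_pi_apply i))
  convert h2 using 1
  · ext ω i
    simp only [ind, ← hA, Function.comp]
    cases J i ω <;> rfl
  · ext ω i
    simp only [ind, ← hA', Function.comp]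
    cases J' i ω <;> rfl

end BoolProcess

/-! ### Extension of consistent word probabilities to ℤ -/

section Extension

variable {S : Type*} [Fintype S]

/-- The sum of `f` over all words of length `n`. -/
def wordSum {M : Type*} [AddCommMonoid M] : ℕ → (List S → M) → M
  | 0, f => f []
  | n + 1, f => ∑ s, wordSum n fun w => f (s :: w)

lemma wordSum_congr {M : Type*} [AddCommMonoid M] {n : ℕ} {f g : List S → M}
    (h : ∀ w : List S, w.length = n → f w = g w) : wordSum n f = wordSum n g := by
  induction n generalizing f g with
  | zero => exact h [] rfl
  | succ n ih =>
    exact Finset.sum_congr rfl fun s _ => ih fun w hw => h _ (by simp [hw])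

lemma wordSum_add {M : Type*} [AddCommMonoid M] (m n : ℕ) (f : List S → M) :
    wordSum (m + n) f = wordSum m fun u => wordSum n fun v => f (u ++ v) := by
  induction m generalizing f with
  | zero => simp [wordSum]
  | succ m ih =>
    rw [Nat.add_right_comm]
    simp only [wordSum, ih, List.cons_append]

lemma wordSum_map {M N : Type*} [AddCommMonoid M] [AddCommMonoid N] (φ : M →+ N) (n : ℕ)
    (f : List S → M) : φ (wordSum n f) = wordSum n fun w => φ (f w) := by
  induction n generalizing f with
  | zero => rfl
  | succ n ih => simp only [wordSum, map_sum, ih]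

lemma wordSum_zero {M : Type*} [AddCommMonoid M] (n : ℕ) :
    wordSum n (fun _ : List S => (0 : M)) = 0 := by
  induction n with
  | zero => rfl
  | succ n ih => simp [wordSum, ih]

lemma wordSum_sum {M : Type*} [AddCommMonoid M] {ι : Type*} (I : Finset ι) (n : ℕ)
    (f : ι → List S → M) :
    ∑ i ∈ I, wordSum n (f i) = wordSum n fun w => ∑ i ∈ I, f i w := by
  induction n generalizing f with
  | zero => rfl
  | succ n ih =>
    simp only [wordSum]
    rw [Finset.sum_comm]
    exact Finset.sum_congr rfl fun s _ => ih _

lemma wordSum_ite [DecidableEq S] {M : Type*} [AddCommMonoid M] (v : List S) (f : List S → M) :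
    wordSum v.length (fun w => if w = v then f w else 0) = f v := by
  induction v generalizing f with
  | nil => simp [wordSum]
  | cons s v ih =>
    rw [List.length_cons, wordSum, Finset.sum_eq_single s]
    · simpa using ih fun w => f (s :: w)
    · intro t _ ht
      simp [ht, wordSum_zero]
    · simp

lemma wordSum_append_right {p : List S → ENNReal} (h : ∀ w, ∑ s, p (w ++ [s]) = p w) (n : ℕ)
    (u : List S) : wordSum n (fun v => p (u ++ v)) = p u := by
  induction n generalizing u with
  | zero => simp [wordSum]
  | succ n ih =>
    rw [wordSum, ← h u]
    refine Finset.sum_congr rfl fun s _ => ?_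
    simpa using ih (u ++ [s])

lemma wordSum_append_left {p : List S → ENNReal} (h : ∀ w, ∑ s, p (s :: w) = p w) (n : ℕ)
    (v : List S) : wordSum n (fun u => p (u ++ v)) = p v := by
  induction n generalizing v with
  | zero => simp [wordSum]
  | succ n ih =>
    simp only [wordSum, List.cons_append, wordSum_sum, h, ih]

variable [Inhabited S]

/-- The word `w` placed from position `a` on, and a default letter elsewhere. -/
def placeWord (a : ℤ) (w : List S) (i : ℤ) : S := w.getD (i - a).toNat default

omit [Fintype S] in
lemma placeWord_mem_wordEvent {u v w t : List S} {a b : ℤ} (hb : b = a + u.length)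
    (h : w.length = v.length) :
    placeWord a (u ++ (w ++ t)) ∈ wordEvent (fun i (x : ℤ → S) => x i) b v ↔ w = v := by
  rw [mem_wordEvent, List.ext_getElem_iff]
  have key (i : ℕ) (hi : i < w.length) : placeWord a (u ++ (w ++ t)) (b + i) = w[i] := by
    have : (b + i - a).toNat = u.length + i := by omega
    rw [placeWord, this, List.getD_append_right _ _ _ _ (by omega),
      List.getD_append _ _ _ _ (by omega), List.getD_eq_getElem _ _ (by omega)]
    congr 1
    omega
  constructor
  · intro hm
    refine ⟨h, fun i h1 h2 => ?_⟩
    rw [← key i h1]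
    exact hm i h2
  · rintro ⟨_, hm⟩ i hi
    rw [key i (by omega)]
    exact hm i _ _

variable [MeasurableSpace S]

/-- The law of a random word of length `2 n` placed on `[-n, n)`. -/
noncomputable def placedLaw (p : List S → ENNReal) (n : ℕ) : Measure (ℤ → S) :=
  wordSum (2 * n) fun w => p w • Measure.dirac (placeWord (-n) w)

variable [MeasurableSingletonClass S]

lemma placedLaw_wordEvent {p : List S → ENNReal} (hr : ∀ w, ∑ s, p (w ++ [s]) = p w)
    (hl : ∀ w, ∑ s, p (s :: w) = p w) {n : ℕ} {a : ℤ} {v : List S} (h1 : -n ≤ a)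
    (h2 : a + v.length ≤ n) :
    placedLaw p n (wordEvent (fun i (x : ℤ → S) => x i) a v) = p v := by
  classical
  have hE : MeasurableSet (wordEvent (fun i (x : ℤ → S) => x i) a v) :=
    measurableSet_wordEvent_of_measurable (fun i => measurable_pi_apply i) a v
  let φ : Measure (ℤ → S) →+ ENNReal :=
    { toFun := fun μ => μ (wordEvent (fun i (x : ℤ → S) => x i) a v)
      map_zero' := rfl
      map_add' := fun μ ν => rfl }
  change φ (placedLaw p n) = p v
  -- Cut the window into the letters before, under and after `v`; the event fixes the middle part,
  -- and consistency on each side sums out the rest.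
  rw [placedLaw, wordSum_map, show 2 * n = (a + n).toNat + (v.length + (n - a - v.length).toNat)
    by omega, wordSum_add]
  rw [← wordSum_append_left hl (a + n).toNat v]
  refine wordSum_congr fun u hu => ?_
  rw [wordSum_add, ← wordSum_ite v fun v => p (u ++ v)]
  refine wordSum_congr fun w hw => ?_
  have (t : List S) : φ (p (u ++ (w ++ t)) • Measure.dirac (placeWord (-n) (u ++ (w ++ t)))) =
      if w = v then p (u ++ w ++ t) else 0 := by
    change (p (u ++ (w ++ t)) • Measure.dirac (placeWord (-n) (u ++ (w ++ t))))
      (wordEvent (fun i (x : ℤ → S) => x i) a v) = _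
    rw [Measure.smul_apply, Measure.dirac_apply' _ hE, Set.indicator_apply]
    simp only [placeWord_mem_wordEvent (t := t) (show a = -n + (u.length : ℤ) by omega) hw]
    simp
  simp only [this]
  split_ifs
  · exact wordSum_append_right hr _ _
  · exact wordSum_zero _

/-- Kolmogorov extension: consistent word probabilities over a finite alphabet are those of a
process indexed by `ℤ`. -/
lemma exists_measure_wordEvent [TopologicalSpace S] [DiscreteTopology S]
    {p : List S → ENNReal} (h0 : p [] = 1)
    (hr : ∀ w, ∑ s, p (w ++ [s]) = p w) (hl : ∀ w, ∑ s, p (s :: w) = p w) :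
    ∃ μ : Measure (ℤ → S), IsProbabilityMeasure μ ∧
      ∀ a v, μ (wordEvent (fun i (x : ℤ → S) => x i) a v) = p v := by
  have : BorelSpace S := by
    constructor
    rw [borel_eq_top_of_discrete]
    exact eq_top_iff.2 fun s _ => (Set.toFinite s).measurableSet
  have hprob (n) : IsProbabilityMeasure (placedLaw p n) := by
    constructor
    rw [← h0, ← placedLaw_wordEvent hr hl (n := n) (a := 0) (v := []) (by simp) (by simp)]
    rfl
  let ν (n : ℕ) : ProbabilityMeasure (ℤ → S) := ⟨placedLaw p n, hprob n⟩
  -- Probability measures on a compact product of finite spaces form a compact space, so a limit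
  -- along an ultrafilter exists. Cylinders are clopen, hence have null frontier, and their measures
  -- are eventually constant.
  obtain ⟨μ, -, hμ⟩ := isCompact_univ.ultrafilter_le_nhds
    ((Filter.hyperfilter ℕ).map ν) (by simp)
  refine ⟨μ, inferInstance, fun a v => ?_⟩
  have hclopen : IsClopen (wordEvent (fun i (x : ℤ → S) => x i) a v) := by
    induction v generalizing a with
    | nil => exact isClopen_univ
    | cons s v ih =>
      exact ((isClopen_discrete {s}).preimage (continuous_apply a)).inter (ih _)
  have htend : Filter.Tendsto ν (Filter.hyperfilter ℕ) (nhds μ) := hμ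
  have hlim := ProbabilityMeasure.tendsto_measure_of_null_frontier_of_tendsto' htend
    (E := wordEvent (fun i (x : ℤ → S) => x i) a v) (by simp [hclopen.frontier_eq])
  refine tendsto_nhds_unique hlim (tendsto_const_nhds.congr' ?_)
  have hev : ∀ᶠ n in Filter.atTop, p v =
      (ν n : Measure (ℤ → S)) (wordEvent (fun i (x : ℤ → S) => x i) a v) := by
    filter_upwards [Filter.eventually_ge_atTop (a.natAbs + v.length)] with n hn
    exact (placedLaw_wordEvent hr hl (by omega) (by omega)).symm
  rw [← Nat.cofinite_eq_atTop] at hev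
  exact hev.filter_mono Filter.hyperfilter_le_cofinite

end Extension

/-! ### Block factors of i.i.d. sequences: descents and peaks -/

section IID

variable {E : Type*} [MeasurableSpace E]

/-- The `σ`-algebra generated by the coordinates in `A`. -/
abbrev coordinateSigma (E : Type*) [MeasurableSpace E] (A : Set ℤ) : MeasurableSpace (ℤ → E) :=
  ⨆ j ∈ A, MeasurableSpace.comap (fun U : ℤ → E => U j) inferInstance

lemma measurable_coordinateSigma {A : Set ℤ} {j : ℤ} (hj : j ∈ A) :
    Measurable[coordinateSigma E A] fun U : ℤ → E => U j :=
  Measurable.mono (comap_measurable _)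
    (le_iSup₂_of_le (f := fun j (_ : j ∈ A) =>
      MeasurableSpace.comap (fun U : ℤ → E => U j) inferInstance) j hj le_rfl) le_rfl

lemma indep_coordinateSigma (ν : Measure E) [IsProbabilityMeasure ν] {A B : Set ℤ}
    (h : Disjoint A B) :
    Indep (coordinateSigma E A) (coordinateSigma E B) (Measure.infinitePi fun _ : ℤ => ν) := by
  refine indep_iSup_of_disjoint (fun j => (measurable_pi_apply j).comap_le) ?_ h
  have := iIndepFun_infinitePi (P := fun _ : ℤ => ν) (X := fun _ x => x) fun _ => measurable_id
  exact (iIndepFun_iff_iIndep _ _ _).1 this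

/-- A block factor of an i.i.d. sequence is finitely dependent. -/
lemma isWordDependent_of_block (ν : Measure E) [IsProbabilityMeasure ν]
    {J : ℤ → (ℤ → E) → Bool} {c d : ℤ} {k : ℕ} (hk : c + d ≤ k)
    (hJ : ∀ (A : Set ℤ) (i : ℤ), Set.Icc (i - c) (i + d) ⊆ A →
      Measurable[coordinateSigma E A] (J i)) :
    IsWordDependent k J (Measure.infinitePi fun _ : ℤ => ν) := by
  intro a u v
  -- The left word reads coordinates up to its last site plus d, the right one from its first site
  -- minus c; `c + d ≤ k` separates them.
  have hdis : Disjoint (Set.Iic (a + u.length - 1 + d)) (Set.Ici (a + u.length + k - c)) := by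
    rw [Set.disjoint_left]
    intro x hx hx'
    simp only [Set.mem_Iic, Set.mem_Ici] at hx hx'
    omega
  have := (Indep_iff _ _ _).1 (indep_coordinateSigma ν hdis) _ _
    (measurableSet_wordEvent (X := J) (a := a) (w := u) fun i _ hi => hJ _ _ ?_)
    (measurableSet_wordEvent (X := J) (a := a + u.length + k) (w := v) fun i hi _ => hJ _ _ ?_)
  · simp only [measureReal_def, this, ENNReal.toReal_mul]
  · intro x hx
    simp only [Set.mem_Icc, Set.mem_Iic] at hx ⊢
    omega
  · intro x hx
    simp only [Set.mem_Icc, Set.mem_Ici] at hx ⊢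
    omega

lemma measurable_decide {Ω : Type*} {m : MeasurableSpace Ω} {p : Ω → Prop} [DecidablePred p]
    (h : MeasurableSet {ω | p ω}) : Measurable fun ω => decide (p ω) := by
  refine measurable_to_bool ?_
  convert h using 1
  ext ω
  simp

lemma coordinateSigma_le (A : Set ℤ) : coordinateSigma E A ≤ MeasurableSpace.pi :=
  iSup₂_le fun j _ => (measurable_pi_apply j).comap_le

variable [LinearOrder E]

/-- The indicator of a descent at `i`. -/
def descent (i : ℤ) (U : ℤ → E) : Bool := decide (U i > U (i + 1))

/-- The indicator of a peak at `i`. -/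
def peak (i : ℤ) (U : ℤ → E) : Bool := decide (U (i - 1) < U i ∧ U i > U (i + 1))

lemma measurable_descent (hE : MeasurableSet {p : E × E | p.1 < p.2}) (A : Set ℤ) (i : ℤ)
    (h : Set.Icc (i - 0) (i + 1) ⊆ A) : Measurable[coordinateSigma E A] (descent i) := by
  have h1 := (measurable_coordinateSigma (E := E) (h (show i ∈ _ by simp)))
  have h2 := (measurable_coordinateSigma (E := E) (h (show i + 1 ∈ _ by simp)))
  exact measurable_decide (hE.preimage (h2.prodMk h1))

lemma measurable_peak (hE : MeasurableSet {p : E × E | p.1 < p.2}) (A : Set ℤ) (i : ℤ)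
    (h : Set.Icc (i - 1) (i + 1) ⊆ A) : Measurable[coordinateSigma E A] (peak i) := by
  have h0 := (measurable_coordinateSigma (E := E) (h (show i - 1 ∈ _ by simp; omega)))
  have h1 := (measurable_coordinateSigma (E := E) (h (show i ∈ _ by simp)))
  have h2 := (measurable_coordinateSigma (E := E) (h (show i + 1 ∈ _ by simp; omega)))
  exact measurable_decide
    ((hE.preimage (h0.prodMk h1)).inter (hE.preimage (h2.prodMk h1)))

lemma isWordDependent_descent (hE : MeasurableSet {p : E × E | p.1 < p.2}) (ν : Measure E)
    [IsProbabilityMeasure ν] : IsWordDependent 1 descent (Measure.infinitePi fun _ : ℤ => ν) :=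
  isWordDependent_of_block ν (c := 0) (d := 1) (by simp) (measurable_descent hE)

lemma isWordDependent_peak (hE : MeasurableSet {p : E × E | p.1 < p.2}) (ν : Measure E)
    [IsProbabilityMeasure ν] : IsWordDependent 2 peak (Measure.infinitePi fun _ : ℤ => ν) :=
  isWordDependent_of_block ν (c := 1) (d := 1) (by simp) (measurable_peak hE)

lemma measurable_descent_pi (hE : MeasurableSet {p : E × E | p.1 < p.2}) (i : ℤ) :
    Measurable (descent (E := E) i) :=
  (measurable_descent hE _ i subset_rfl).mono (coordinateSigma_le _) le_rfl

lemma measurable_peak_pi (hE : MeasurableSet {p : E × E | p.1 < p.2}) (i : ℤ) :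
    Measurable (peak (E := E) i) :=
  (measurable_peak hE _ i subset_rfl).mono (coordinateSigma_le _) le_rfl

end IID

/-! ### Runs of descents of uniform variables -/

section Uniform

open unitInterval

/-- Decreasing sequences of length `n` in `[0, t)`. -/
def decreasingBelow : ∀ n : ℕ, I → Set (Fin n → I)
  | 0, _ => Set.univ
  | n + 1, t => {u | u 0 < t ∧ (fun i => u (Fin.succ i)) ∈ decreasingBelow n (u 0)}

/-- The threshold varies with the parameter because the recursion replaces it by the first
coordinate. -/
lemma measurableSet_decreasingBelow {Ω : Type*} [MeasurableSpace Ω] (n : ℕ) {t : Ω → I}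
    (ht : Measurable t) {u : Ω → Fin n → I} (hu : Measurable u) :
    MeasurableSet {ω | u ω ∈ decreasingBelow n (t ω)} := by
  induction n generalizing t with
  | zero => simp [decreasingBelow]
  | succ n ih =>
    simp only [decreasingBelow]
    exact (measurableSet_lt (by fun_prop) ht).inter (ih (by fun_prop) (by fun_prop))

lemma lintegral_unitInterval_pow (n : ℕ) (t : I) :
    ∫⁻ x in Set.Iio t, ENNReal.ofReal ((x : ℝ) ^ n / n.factorial) =
      ENNReal.ofReal ((t : ℝ) ^ (n + 1) / (n + 1).factorial) := by
  have hpre : Set.Iio t = ((↑) : I → ℝ) ⁻¹' Set.Iio (t : ℝ) := by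
    ext x
    simp
  rw [hpre, measurePreserving_coe.setLIntegral_comp_preimage measurableSet_Iio
    (f := fun x : ℝ => ENNReal.ofReal (x ^ n / n.factorial)) (by fun_prop),
    Measure.restrict_restrict measurableSet_Iio]
  have hI : Set.Iio (t : ℝ) ∩ I = Set.Ico 0 (t : ℝ) := by
    ext x
    simp only [Set.mem_inter_iff, Set.mem_Iio, unitInterval, Set.mem_Icc, Set.mem_Ico]
    have := t.2.2
    constructor
    · rintro ⟨h1, h2, _⟩
      exact ⟨h2, h1⟩
    · rintro ⟨h1, h2⟩
      exact ⟨h2, h1, by linarith⟩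
  rw [hI, ← ofReal_integral_eq_lintegral_ofReal]
  · rw [integral_Ico_eq_integral_Ioc, ← intervalIntegral.integral_of_le t.2.1]
    simp only [intervalIntegral.integral_div, integral_pow]
    congr 1
    rw [Nat.factorial_succ]
    push_cast
    field_simp
    simp
  · exact (Continuous.integrableOn_Icc (by fun_prop)).mono_set Set.Ico_subset_Icc_self
  · refine (ae_restrict_mem measurableSet_Ico).mono fun x hx => ?_
    have := hx.1
    positivity

lemma volume_decreasingBelow (n : ℕ) (t : I) :
    (Measure.pi fun _ => volume) (decreasingBelow n t) =
      ENNReal.ofReal ((t : ℝ) ^ n / n.factorial) := by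
  induction n generalizing t with
  | zero => simp [decreasingBelow]
  | succ n ih =>
    have hmp := measurePreserving_piFinSuccAbove (fun _ : Fin (n + 1) => (volume : Measure I)) 0
    let T : Set (I × (Fin n → I)) := {p | p.1 < t ∧ p.2 ∈ decreasingBelow n p.1}
    have hT : MeasurableSet T := (measurableSet_lt measurable_fst measurable_const).inter
      (measurableSet_decreasingBelow n measurable_fst measurable_snd)
    have hpre : decreasingBelow (n + 1) t =
        (MeasurableEquiv.piFinSuccAbove (fun _ : Fin (n + 1) => I) 0) ⁻¹' T := by
      ext u
      rfl
    rw [hpre, hmp.measure_preimage hT.nullMeasurableSet, Measure.prod_apply hT,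
      ← lintegral_unitInterval_pow, ← lintegral_indicator measurableSet_Iio]
    refine lintegral_congr fun x => ?_
    by_cases hx : x < t
    · rw [Set.indicator_of_mem (show x ∈ Set.Iio t from hx), ← ih]
      congr 1
      ext v
      simp [T, hx]
    · rw [Set.indicator_of_notMem (show x ∉ Set.Iio t from hx)]
      simp [T, hx]

lemma volume_decreasing (n : ℕ) :
    (Measure.pi fun _ => volume)
      {u : Fin (n + 1) → I | (fun i => u (Fin.succ i)) ∈ decreasingBelow n (u 0)} =
      ENNReal.ofReal (1 / (n + 1).factorial) := by
  have hmp := measurePreserving_piFinSuccAbove (fun _ : Fin (n + 1) => (volume : Measure I)) 0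
  let T : Set (I × (Fin n → I)) := {p | p.2 ∈ decreasingBelow n p.1}
  have hT : MeasurableSet T := measurableSet_decreasingBelow n measurable_fst measurable_snd
  have hpre : {u : Fin (n + 1) → I | (fun i => u (Fin.succ i)) ∈ decreasingBelow n (u 0)} =
      (MeasurableEquiv.piFinSuccAbove (fun _ : Fin (n + 1) => I) 0) ⁻¹' T := by
    ext u
    rfl
  rw [hpre, hmp.measure_preimage hT.nullMeasurableSet, Measure.prod_apply hT]
  -- The first coordinate is unrestricted here, which differs from being below 1 by a null set.
  have := lintegral_unitInterval_pow n 1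
  rw [Measure.restrict_congr_set Iio_ae_eq_Iic,
    show Set.Iic (1 : I) = Set.univ from Set.Iic_top, Measure.restrict_univ] at this
  simp only [Set.Icc.coe_one, one_pow] at this
  rw [← this]
  exact lintegral_congr fun x => volume_decreasingBelow n x

instance : IsProbabilityMeasure iidUniform := by
  unfold iidUniform
  infer_instance

lemma mem_decreasingBelow_iff (U : ℤ → I) (n : ℕ) (b : ℤ) :
    (fun i : Fin n => U (b + 1 + i)) ∈ decreasingBelow n (U b) ↔
      U ∈ wordEvent descent b (List.replicate n true) := by
  induction n generalizing b with
  | zero => simp [decreasingBelow, wordEvent]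
  | succ n ih =>
    simp only [decreasingBelow, List.replicate_succ, wordEvent, Set.mem_inter_iff,
      Set.mem_ofPred_eq, ← ih, descent, decide_eq_true_eq, Fin.val_zero, Fin.val_succ]
    push_cast
    simp only [add_zero, gt_iff_lt]
    have (i : Fin n) : b + 1 + ((i : ℤ) + 1) = b + 1 + 1 + i := by ring
    simp only [this]

lemma iidUniform_descent_run (a : ℤ) (n : ℕ) :
    iidUniform.real (wordEvent descent a (List.replicate n true)) = 1 / (n + 1).factorial := by
  have hinj : Function.Injective fun i : Fin (n + 1) => a + (i : ℤ) := by
    intro i j h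
    ext
    simpa using h
  have hmap := Measure.map_infinitePi_infinitePi_of_inj
    (P := fun _ : ℤ => (volume : Measure I)) hinj
  rw [Measure.infinitePi_eq_pi (μ := fun _ : Fin (n + 1) => (volume : Measure I))] at hmap
  have := volume_decreasing n
  rw [← hmap, Measure.map_apply (by fun_prop)] at this
  · have hset : (fun (U : ℤ → I) (i : Fin (n + 1)) => U (a + i)) ⁻¹'
        {u | (fun i => u (Fin.succ i)) ∈ decreasingBelow n (u 0)} =
        wordEvent descent a (List.replicate n true) := by
      ext U
      rw [← mem_decreasingBelow_iff]
      simp only [Set.mem_preimage, Set.mem_ofPred_eq, Fin.val_zero, Fin.val_succ]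
      push_cast
      have (i : Fin n) : a + ((i : ℤ) + 1) = a + 1 + i := by ring
      simp only [this, add_zero]
    rw [hset] at this
    rw [measureReal_def, iidUniform, this, ENNReal.toReal_ofReal (by positivity)]
  · exact measurableSet_decreasingBelow n (by fun_prop) (by fun_prop)

lemma measurableSet_lt_unitInterval : MeasurableSet {p : I × I | p.1 < p.2} :=
  measurableSet_lt measurable_fst measurable_snd

/-- Without ties a non-descent is a strict ascent, so peaks can be read off the descents. -/
lemma iidUniform_ae_ne : ∀ᵐ U ∂iidUniform, ∀ i, U i ≠ U (i + 1) := by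
  rw [ae_all_iff]
  intro i
  have hmap := Measure.infinitePi_map_eval_prod (P := fun _ : ℤ => (volume : Measure I))
    (show i ≠ i + 1 by omega)
  have hd : MeasurableSet {p : I × I | p.1 ≠ p.2} :=
    (measurableSet_eq_fun measurable_fst measurable_snd).compl
  have : ∀ᵐ p ∂((volume : Measure I).prod volume), p.1 ≠ p.2 := by
    rw [ae_iff, Measure.measure_prod_null]
    · refine Filter.Eventually.of_forall fun x => ?_
      simp
    · exact hd.compl
  rw [← hmap, ae_map_iff (by fun_prop) hd] at this
  exact this

end Uniform

/-! ### Descent words without a rise -/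

section NoRise

variable {Ω : Type*} [MeasurableSpace Ω] {J : ℤ → Ω → Bool} {P : Measure Ω}

/-- Write 1^j 0^(l+1) as the product of 1^j and 0^l minus 1^(j+1) 0^l. The zero run is the case j =
0 at smaller length, and Pascal's rule closes the induction. -/
lemma IsWordDependent.ones_zeros [IsProbabilityMeasure P] (hJ : ∀ i, Measurable (J i))
    (h : IsWordDependent 1 J P)
    (hrun : ∀ a n, P.real (wordEvent J a (List.replicate n true)) = 1 / (n + 1).factorial)
    (j l : ℕ) :
    ∀ a, P.real (wordEvent J a (List.replicate j true ++ List.replicate l false)) =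
      (j + l).choose j / (j + l + 1).factorial := by
  induction hN : j + l using Nat.strong_induction_on generalizing j l with
  | _ N ih =>
  induction l generalizing j with
  | zero =>
    intro a
    simp only [add_zero] at hN
    simp [hrun, hN]
  | succ l ihl =>
    intro a
    have e := h.true_add_false hJ a (List.replicate j true) (List.replicate l false)
    have e1 : List.replicate j true ++ true :: List.replicate l false =
        List.replicate (j + 1) true ++ List.replicate l false := by
      rw [List.replicate_succ']
      simp
    have e2 := ih l (by omega) 0 l (by simp) (a + (List.replicate j true).length + 1)
    rw [e1, ihl (j + 1) (by omega) a, hrun] at e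
    simp only [List.replicate_zero, List.nil_append] at e2
    rw [e2, ← List.replicate_succ] at e
    rw [eq_sub_of_add_eq' e]
    have hc : (N.choose j : ℝ) + N.choose (j + 1) =
        (N + 1).factorial / ((j + 1).factorial * (l + 1).factorial) := by
      rw [← Nat.cast_add, ← Nat.choose_succ_succ', Nat.cast_choose ℝ (by omega),
        show N + 1 - (j + 1) = l + 1 by omega]
    rw [eq_sub_of_add_eq hc]
    simp only [Nat.choose_zero_right, Nat.cast_one]
    field_simp

/-- On the `n` positions from `a` on, no zero is immediately followed by a one. -/
def noRise (J : ℤ → Ω → Bool) : ℤ → ℕ → Set Ω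
  | _, 0 => Set.univ
  | a, n + 1 => ({ω | J a ω = true} ∩ noRise J (a + 1) n) ∪
      wordEvent J a (List.replicate (n + 1) false)

/-- A word without a rise is 1^i 0^(n-i). The prefix of j ones is carried so that the induction can
move past a leading one. -/
lemma measureReal_inter_noRise [IsFiniteMeasure P] (hJ : ∀ i, Measurable (J i)) (a : ℤ)
    (j n : ℕ) :
    P.real (wordEvent J a (List.replicate j true) ∩ noRise J (a + j) n) =
      ∑ i ∈ Finset.range (n + 1),
        P.real (wordEvent J a (List.replicate (j + i) true ++ List.replicate (n - i) false)) := by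
  induction n generalizing j with
  | zero => simp [noRise]
  | succ n ih =>
    rw [Finset.sum_range_succ']
    have h1 : wordEvent J a (List.replicate j true) ∩ noRise J (a + j) (n + 1) =
        (wordEvent J a (List.replicate (j + 1) true) ∩ noRise J (a + (j + 1 : ℕ)) n) ∪
        wordEvent J a (List.replicate j true ++ List.replicate (n + 1) false) := by
      rw [List.replicate_succ' (n := j), wordEvent_append, wordEvent_append, noRise]
      simp only [wordEvent, List.length_replicate, Set.inter_univ, Set.inter_union_distrib_left,
        Set.inter_assoc]
      push_cast
      rw [add_assoc]
    rw [h1, measureReal_union]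
    · rw [ih]
      congr 1
      refine Finset.sum_congr rfl fun i _ => ?_
      rw [Nat.add_sub_add_right, add_assoc, add_comm 1 i]
    · rw [Set.disjoint_left]
      intro ω h1 h2
      rw [List.replicate_succ', wordEvent_append] at h1
      rw [List.replicate_succ, wordEvent_append] at h2
      simp only [wordEvent, Set.mem_inter_iff, Set.mem_ofPred_eq] at h1 h2
      simp only [List.length_replicate] at h1
      simp [h1.1.2.1] at h2
    · exact measurableSet_wordEvent_of_measurable hJ _ _

lemma IsWordDependent.measureReal_noRise [IsProbabilityMeasure P] (hJ : ∀ i, Measurable (J i))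
    (h : IsWordDependent 1 J P)
    (hrun : ∀ a n, P.real (wordEvent J a (List.replicate n true)) = 1 / (n + 1).factorial)
    (a : ℤ) (n : ℕ) : P.real (noRise J a n) = 2 ^ n / (n + 1).factorial := by
  have := measureReal_inter_noRise (P := P) hJ a 0 n
  simp only [List.replicate_zero, wordEvent, Set.univ_inter, Nat.cast_zero, add_zero, zero_add]
    at this
  rw [this, ← Nat.cast_two, ← Nat.cast_pow, ← Nat.sum_range_choose, Nat.cast_sum, Finset.sum_div]
  refine Finset.sum_congr rfl fun i hi => ?_
  rw [Finset.mem_range] at hi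
  rw [h.ones_zeros hJ hrun, show i + (n - i) = n by omega]

end NoRise

/-! ### Runs without peaks -/

section Peak

open unitInterval

/-- A peak at i is a non-descent at i - 1 followed by a descent at i, so k sites without a peak
correspond to k + 1 descent indicators without a rise. -/
lemma mem_wordEvent_peak_iff {U : ℤ → I} (hU : ∀ i, U i ≠ U (i + 1)) (k : ℕ) (b : ℤ) :
    U ∈ wordEvent peak (b + 1) (List.replicate k false) ↔ U ∈ noRise descent b (k + 1) := by
  induction k generalizing b with
  | zero =>
    simp only [List.replicate_zero, wordEvent, noRise, List.replicate_succ, Set.inter_univ,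
      Set.mem_univ, true_iff, Set.mem_union, Set.mem_ofPred_eq]
    cases descent b U <;> simp
  | succ k ih =>
    rw [List.replicate_succ, wordEvent, noRise, Set.mem_inter_iff, ih (b + 1)]
    have hpk : peak (b + 1) U = (!descent b U && descent (b + 1) U) := by
      simp only [peak, descent, Bool.decide_and, add_sub_cancel_right]
      congr 1
      rw [Bool.eq_iff_iff]
      have := hU b
      simp only [decide_eq_true_eq, Bool.not_eq_true', decide_eq_false_iff_not, not_lt, gt_iff_lt]
      exact ⟨le_of_lt, fun h => lt_of_le_of_ne h this⟩
    simp only [Set.mem_ofPred_eq, hpk, noRise, Set.mem_union, Set.mem_inter_iff,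
      List.replicate_succ, wordEvent]
    cases descent b U <;> cases descent (b + 1) U <;> simp

lemma iidUniform_peak_zero_run (a : ℤ) (n : ℕ) :
    iidUniform.real (wordEvent peak a (List.replicate n false)) =
      2 ^ (n + 1) / (n + 2).factorial := by
  rw [← (isWordDependent_descent measurableSet_lt_unitInterval volume).measureReal_noRise
    (measurable_descent_pi measurableSet_lt_unitInterval) iidUniform_descent_run (a - 1) (n + 1)]
  refine measureReal_congr ?_
  filter_upwards [iidUniform_ae_ne] with U hU
  have := mem_wordEvent_peak_iff hU n (a - 1)
  rw [sub_add_cancel] at this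
  exact propext this

lemma iidUniform_peak_pair (a : ℤ) : iidUniform.real (wordEvent peak a [true, true]) = 0 := by
  have : wordEvent (peak (E := I)) a [true, true] = ∅ := by
    ext U
    simp only [wordEvent, peak, decide_eq_true_eq, add_sub_cancel_right, Set.inter_univ,
      Set.mem_inter_iff, Set.mem_ofPred_eq, Set.mem_empty_iff_false, iff_false, not_and]
    intro h h' h''
    exact absurd h.2 (not_lt.2 h'.le)
  rw [this, measureReal_empty]

end Peak

/-! ### Descents of fair bits -/

section FairBits

instance : IsProbabilityMeasure fairBits := by
  unfold fairBits
  infer_instance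

lemma measurableSet_lt_fin : MeasurableSet {p : Fin 2 × Fin 2 | p.1 < p.2} :=
  (Set.toFinite _).measurableSet

lemma fairBits_descent (a : ℤ) : fairBits.real (wordEvent descent a [true]) = 1 / 4 := by
  have hset : wordEvent (descent (E := Fin 2)) a [true] =
      Set.pi (({a, a + 1} : Finset ℤ) : Set ℤ) fun i => if i = a then {1} else {0} := by
    ext U
    simp [wordEvent, descent, Set.pi]
    generalize U a = x
    generalize U (a + 1) = y
    revert x y
    decide
  have huni (x : Fin 2) : (PMF.uniformOfFintype (Fin 2)).toMeasure {x} = 2⁻¹ := by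
    rw [PMF.toMeasure_apply_singleton _ _ (measurableSet_singleton x)]
    simp
  rw [hset, measureReal_def, fairBits, Measure.infinitePi_pi _
    (fun i _ => (Set.toFinite _).measurableSet), Finset.prod_pair (by omega)]
  simp [huni]
  norm_num

lemma fairBits_descent_run (a : ℤ) (n : ℕ) :
    fairBits.real (wordEvent descent a (List.replicate (n + 2) true)) = 0 := by
  have : wordEvent (descent (E := Fin 2)) a (List.replicate (n + 2) true) = ∅ := by
    ext U
    simp only [List.replicate_succ, wordEvent, descent, decide_eq_true_eq,
      Set.mem_inter_iff, Set.mem_ofPred_eq, Set.mem_empty_iff_false, iff_false]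
    rintro ⟨h1, h2, -⟩
    omega
  rw [this, measureReal_empty]

end FairBits

/-! ### Stationarity on cylinder events -/

section Stationary

variable {Ω S : Type*}

lemma wordEvent_preimage {Ω₀ : Type*} (X : ℤ → Ω₀ → S) (g : Ω → Ω₀) (a : ℤ) (w : List S) :
    wordEvent (fun i ω => X i (g ω)) a w = g ⁻¹' wordEvent X a w := by
  ext ω
  simp only [mem_wordEvent, Set.mem_preimage]

lemma wordEvent_shift (X : ℤ → Ω → S) (a : ℤ) (w : List S) :
    wordEvent (fun i => X (i + 1)) a w = wordEvent X (a + 1) w := by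
  ext ω
  simp only [mem_wordEvent, add_right_comm]

lemma measureReal_eq_sum_inter [MeasurableSpace Ω] [Fintype S] [MeasurableSpace S]
    [MeasurableSingletonClass S] {P : Measure Ω} [IsFiniteMeasure P] {f : Ω → S}
    (hf : Measurable f) (A : Set Ω) :
    P.real A = ∑ s, P.real (A ∩ {ω | f ω = s}) := by
  have h := sum_measureReal_preimage_singleton (μ := P.restrict A) Finset.univ (f := f)
    fun s _ => hf (measurableSet_singleton s)
  simp only [Finset.coe_univ, Set.preimage_univ, measureReal_restrict_apply_univ] at h
  rw [← h]
  refine Finset.sum_congr rfl fun s _ => ?_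
  rw [measureReal_restrict_apply (hf (measurableSet_singleton s)), Set.inter_comm]
  rfl

variable [MeasurableSpace Ω] [MeasurableSpace S]

lemma IsStationaryProcess.measureReal_wordEvent {X : ℤ → Ω → S} {P : Measure Ω}
    {T : Type*} [MeasurableSpace T] [MeasurableSingletonClass T]
    (h : IsStationaryProcess X P) {f : S → T} (hf : Measurable f) (w : List T) (a : ℤ) :
    P.real (wordEvent (fun i ω => f (X i ω)) a w) =
      P.real (wordEvent (fun i ω => f (X i ω)) 0 w) := by
  have step (a : ℤ) : P.real (wordEvent (fun i ω => f (X i ω)) (a + 1) w) =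
      P.real (wordEvent (fun i ω => f (X i ω)) a w) := by
    have hm : MeasurableSet (wordEvent (fun i (x : ℤ → S) => f (x i)) a w) :=
      measurableSet_wordEvent_of_measurable (fun i => hf.comp (measurable_pi_apply i)) a w
    have := h.measure_mem_eq hm
    rw [← wordEvent_preimage, ← wordEvent_preimage,
      wordEvent_shift (fun i ω => f (X i ω))] at this
    rw [measureReal_def, measureReal_def, this]
  induction a with
  | zero => rfl
  | succ n ih => rw [step, ih]
  | pred n ih => rw [← ih, ← step (-n - 1), sub_add_cancel]

end Stationary

/-! ### The density bound and the rigidity of (ii) -/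

section HardCore

/-- If p > 1/4, the ratios of consecutive terms follow r ↦ 1 - p/r, which has no fixed point and
drops by at least p - 1/4 on (0, 1], so they eventually become negative. -/
lemma le_quarter_of_recurrence {u : ℕ → ℝ} {p : ℝ} (hu : ∀ n, 0 ≤ u n) (h0 : u 0 = 1)
    (h1 : u 1 = 1 - p) (hrec : ∀ n, u (n + 2) = u (n + 1) - p * u n) : p ≤ 1 / 4 := by
  by_contra! hp
  have hpos (n) : 0 < u n := by
    induction n with
    | zero => rw [h0]; exact one_pos
    | succ n ih =>
      refine lt_of_le_of_ne (hu _) fun h => ?_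
      have := hu (n + 2)
      rw [hrec, ← h] at this
      nlinarith
  have hdec (n) : u (n + 1) ≤ u n := by
    cases n with
    | zero => rw [h0, h1]; linarith
    | succ n =>
      rw [hrec]
      nlinarith [hpos n]
  have hratio (n : ℕ) : u (n + 1) / u n ≤ 1 - n * (p - 1 / 4) := by
    induction n with
    | zero => simpa using div_le_one_of_le₀ (hdec 0) (hu 0)
    | succ n ih =>
      have hr : 0 < u (n + 1) / u n := div_pos (hpos _) (hpos _)
      have hr1 : u (n + 1) / u n ≤ 1 := div_le_one_of_le₀ (hdec n) (hu n)
      have e : u (n + 1 + 1) / u (n + 1) = 1 - p / (u (n + 1) / u n) := by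
        rw [hrec]
        have := hpos n
        have := hpos (n + 1)
        field_simp
      rw [e]
      generalize u (n + 1) / u n = r at *
      have : r - (p - 1 / 4) ≥ 1 - p / r := by
        rw [ge_iff_le, sub_le_iff_le_add, ← sub_le_iff_le_add', le_div_iff₀ hr]
        nlinarith [sq_nonneg (r - 1 / 2)]
      push_cast
      linarith
  obtain ⟨n, hn⟩ := exists_nat_gt (1 / (p - 1 / 4))
  rw [div_lt_iff₀ (by linarith)] at hn
  have := hratio n
  have := div_pos (hpos (n + 1)) (hpos n)
  linarith

variable {Ω : Type*} [MeasurableSpace Ω] {P : Measure Ω}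

/-- In a stationary `1`-dependent `0`-`1` process without adjacent ones, the density of ones is
at most `1 / 4`. -/
lemma IsWordDependent.density_le [IsProbabilityMeasure P] {J : ℤ → Ω → Bool}
    (hJ : ∀ i, Measurable (J i)) (h : IsWordDependent 1 J P)
    (hst : ∀ w a, P.real (wordEvent J a w) = P.real (wordEvent J 0 w))
    (hhc : ∀ a, P.real (wordEvent J a [true, true]) = 0) :
    P.real (wordEvent J 0 [true]) ≤ 1 / 4 := by
  have hsplit (n : ℕ) : P.real (wordEvent J 0 (List.replicate n false ++ [true])) +
      P.real (wordEvent J 0 (List.replicate (n + 1) false)) =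
      P.real (wordEvent J 0 (List.replicate n false)) := by
    have := h.true_add_false hJ 0 (List.replicate n false) []
    simpa [List.replicate_succ', wordEvent] using this
  refine le_quarter_of_recurrence (u := fun n => P.real (wordEvent J 0 (List.replicate n false)))
    (fun n => measureReal_nonneg) (by simp [wordEvent]) ?_ fun n => ?_
  · have := hsplit 0
    simp only [List.replicate_zero, List.nil_append] at this
    simp only [zero_add, wordEvent, probReal_univ] at this ⊢
    linarith
  -- As 0^n 11 is null, 1-dependence gives p u_n for 0^(n+1) 1, which is also u_(n+1) - u_(n+2).
  · have e := h.true_add_false hJ 0 (List.replicate n false) [true]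
    rw [hst [true]] at e
    have hz : P.real (wordEvent J 0 (List.replicate n false ++ [true, true])) = 0 := by
      refine le_antisymm ?_ measureReal_nonneg
      rw [← hhc (0 + (List.replicate n false).length), wordEvent_append]
      exact measureReal_mono Set.inter_subset_right (by finiteness)
    have e2 := hsplit (n + 1)
    have e3 : List.replicate (n + 1) false ++ [true] =
        List.replicate n false ++ [false, true] := by
      rw [List.replicate_succ']
      simp
    rw [e3] at e2
    rw [hz] at e
    linarith

lemma IsDependentColoring.measureReal_pair {k q : ℕ} {X : ℤ → Ω → Fin q}
    (hX : IsDependentColoring k q X P) (c : Fin q) (a : ℤ) :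
    P.real (wordEvent (fun i ω => decide (X i ω = c)) a [true, true]) = 0 := by
  rw [measureReal_def, measure_eq_zero_iff_ae_notMem.2, ENNReal.toReal_zero]
  filter_upwards [hX.proper] with ω hω hmem
  simp only [wordEvent, decide_eq_true_eq, Set.inter_univ, Set.mem_inter_iff,
    Set.mem_ofPred_eq] at hmem
  exact hω a (hmem.1.trans hmem.2.symm)

lemma IsDependentColoring.hasFairDescentMarginal [IsProbabilityMeasure P] {X : ℤ → Ω → Fin 4}
    (hX : IsDependentColoring 1 4 X P) : HasFairDescentMarginal X P := by
  have hf (c : Fin 4) : Measurable fun x : Fin 4 => decide (x = c) := measurable_of_finite _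
  have hJ (c : Fin 4) (i : ℤ) : Measurable fun ω => decide (X i ω = c) :=
    (hf c).comp (hX.measurable i)
  have hdep (c : Fin 4) := hX.dependent.isWordDependent_comp (hf c)
  have hst (c : Fin 4) := hX.stationary.measureReal_wordEvent (hf c)
  have hle (c : Fin 4) := (hdep c).density_le (hJ c) (hst c) (hX.measureReal_pair c)
  have hev (c : Fin 4) : wordEvent (fun i ω => decide (X i ω = c)) 0 [true] =
      {ω | X 0 ω = c} := by
    ext ω
    simp [wordEvent]
  have hsum := measureReal_eq_sum_inter (P := P) (hX.measurable 0) Set.univ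
  simp only [Set.univ_inter, probReal_univ, ← hev, Fin.sum_univ_four] at hsum
  -- Four densities, each at most 1/4, sum to 1.
  have hquarter : P.real (wordEvent (fun i ω => decide (X i ω = 0)) 0 [true]) = 1 / 4 := by
    linarith [hle 0, hle 1, hle 2, hle 3]
  refine identDistrib_ind (J := fun i ω => decide (X i ω = 0)) (J' := descent) (hJ 0)
    (measurable_descent_pi measurableSet_lt_fin) (by simp) (by simp [descent])
    (wordEvent_eq_of_run_eq (hJ 0) (measurable_descent_pi measurableSet_lt_fin) (hdep 0)
      (isWordDependent_descent measurableSet_lt_fin _) ?_)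
  intro a n
  rcases n with _ | _ | n
  · simp only [List.replicate_zero, wordEvent, probReal_univ]
  · simp only [zero_add, List.replicate_one]
    rw [hst, hquarter]
    exact (fairBits_descent a).symm
  · refine Eq.trans (le_antisymm ?_ measureReal_nonneg) (fairBits_descent_run a n).symm
    rw [← hX.measureReal_pair 0 a, show List.replicate (n + 2) true =
      [true, true] ++ List.replicate n true from rfl, wordEvent_append]
    exact measureReal_mono Set.inter_subset_left (by finiteness)

end HardCore

/-! ### The coloring laws and their properties -/

section ColoringLaw

variable {q : ℕ}

/-- The `i`-th coordinate of a sequence. -/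
def coordinate {S : Type*} (i : ℤ) (x : ℤ → S) : S := x i

lemma measurable_coordinate {S : Type*} [MeasurableSpace S] (i : ℤ) :
    Measurable (coordinate (S := S) i) :=
  measurable_pi_apply i

/-- `μ` is the law of a random coloring with the word probabilities `colorProb`. -/
def IsColoringLaw (q : ℕ) (μ : Measure (ℤ → Fin q)) : Prop :=
  ∀ a w, μ.real (wordEvent coordinate a w) = colorProb q w

lemma exists_isColoringLaw (hq : 2 ≤ q) :
    ∃ μ : Measure (ℤ → Fin q), IsProbabilityMeasure μ ∧ IsColoringLaw q μ := by
  have : NeZero q := ⟨by omega⟩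
  have hnn := colorProb_nonneg hq
  obtain ⟨μ, hμ, h⟩ := exists_measure_wordEvent (S := Fin q)
    (p := fun w => ENNReal.ofReal (colorProb q w)) (by simp)
    (fun w => by
      rw [← ENNReal.ofReal_sum_of_nonneg fun _ _ => hnn _, sum_colorProb_append_singleton hq])
    (fun w => by rw [← ENNReal.ofReal_sum_of_nonneg fun _ _ => hnn _, sum_colorProb_cons hq])
  refine ⟨μ, hμ, fun a w => ?_⟩
  change (μ _).toReal = _
  rw [show wordEvent coordinate a w = wordEvent (fun i (x : ℤ → Fin q) => x i) a w from rfl, h,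
    ENNReal.toReal_ofReal (hnn w)]

namespace IsColoringLaw

variable {μ : Measure (ℤ → Fin q)} [IsProbabilityMeasure μ]

lemma identDistrib (hμ : IsColoringLaw q μ) {X : ℤ → (ℤ → Fin q) → Fin q}
    (hX : ∀ i, Measurable (X i)) (h : ∀ a w, μ.real (wordEvent X a w) = colorProb q w) :
    IdentDistrib (fun x (i : ℤ) => coordinate i x) (fun x (i : ℤ) => X i x) μ μ := by
  refine identDistrib_of_wordEvent measurable_coordinate hX fun a w => ?_
  rw [← ENNReal.toReal_eq_toReal_iff' (by finiteness) (by finiteness)]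
  exact (hμ a w).trans (h a w).symm

lemma isStationaryProcess (hμ : IsColoringLaw q μ) : IsStationaryProcess coordinate μ :=
  hμ.identDistrib (fun i => measurable_coordinate (i + 1)) fun a w => by
    rw [wordEvent_shift, hμ]

lemma isReversible (hμ : IsColoringLaw q μ) : IsReversible coordinate μ := by
  refine hμ.identDistrib (fun i => measurable_coordinate (-i)) fun a w => ?_
  -- The reflected word ends at -a, hence starts at b = 1 - a - |w|.
  have key (w : List (Fin q)) : ∀ a b : ℤ, b + w.length = 1 - a →
      wordEvent (fun i => coordinate (S := Fin q) (-i)) a w =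
        wordEvent coordinate b w.reverse := by
    induction w with
    | nil => intro a b _; rfl
    | cons s w ih =>
      intro a b hb
      simp only [List.length_cons, Nat.cast_add, Nat.cast_one] at hb
      rw [List.reverse_cons, wordEvent_append, ← ih (a + 1) b (by omega), List.length_reverse,
        show b + (w.length : ℤ) = -a by omega]
      simp only [wordEvent, Set.inter_univ]
      rw [Set.inter_comm]
  rw [key w a (1 - a - w.length) (by ring), hμ, colorProb_reverse]

lemma isColorSymmetric (hμ : IsColoringLaw q μ) : IsColorSymmetric coordinate μ := by
  intro σ
  refine hμ.identDistrib (X := fun i x => σ (coordinate i x))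
    (fun i => (measurable_of_finite σ).comp (measurable_coordinate i)) fun a w => ?_
  have : wordEvent (fun i (x : ℤ → Fin q) => σ (coordinate i x)) a w =
      wordEvent coordinate a (w.map σ.symm) := by
    ext x
    simp only [mem_wordEvent, List.length_map, List.getElem_map, Equiv.eq_symm_apply]
  rw [this, hμ, colorProb_map σ.symm.injective]

lemma ae_ne (hμ : IsColoringLaw q μ) : ∀ᵐ x ∂μ, ∀ i, coordinate i x ≠ coordinate (i + 1) x := by
  rw [ae_all_iff]
  intro i
  have (c : Fin q) : ∀ᵐ x ∂μ, x ∉ wordEvent coordinate i [c, c] := by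
    rw [← measure_eq_zero_iff_ae_notMem, ← measureReal_eq_zero_iff, hμ, colorProb_pair_self]
  filter_upwards [ae_all_iff.2 this] with x hx h
  apply hx (coordinate i x)
  simp [wordEvent, ← h]

omit [IsProbabilityMeasure μ] in
lemma sum_wordEvent [IsFiniteMeasure μ] (a : ℤ) (u : List (Fin q)) (B : Set (ℤ → Fin q)) :
    μ.real (wordEvent coordinate a u ∩ B) =
      ∑ s, μ.real (wordEvent coordinate a (u ++ [s]) ∩ B) := by
  rw [measureReal_eq_sum_inter (measurable_coordinate (a + u.length))]
  refine Finset.sum_congr rfl fun s _ => ?_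
  rw [wordEvent_append, Set.inter_right_comm]
  simp only [wordEvent, Set.inter_univ]

lemma isWordDependent_four {μ : Measure (ℤ → Fin 4)} [IsProbabilityMeasure μ]
    (hμ : IsColoringLaw 4 μ) : IsWordDependent 1 coordinate μ := by
  intro a u v
  rw [hμ, hμ, ← sum_colorProb_four, sum_wordEvent]
  refine Finset.sum_congr rfl fun s _ => ?_
  rw [← hμ a, show u ++ s :: v = u ++ [s] ++ v by simp, wordEvent_append _ a (u ++ [s])]
  simp [add_assoc]

lemma isWordDependent_three {μ : Measure (ℤ → Fin 3)} [IsProbabilityMeasure μ]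
    (hμ : IsColoringLaw 3 μ) : IsWordDependent 2 coordinate μ := by
  intro a u v
  rw [hμ, hμ, ← sum_colorProb_three, sum_wordEvent]
  refine Finset.sum_congr rfl fun s _ => ?_
  rw [sum_wordEvent]
  refine Finset.sum_congr rfl fun t _ => ?_
  rw [← hμ a, show u ++ s :: t :: v = u ++ [s] ++ [t] ++ v by simp,
    wordEvent_append _ a (u ++ [s] ++ [t])]
  simp [add_assoc]

lemma isDependentColoring (hμ : IsColoringLaw q μ) {k : ℕ}
    (h : IsWordDependent k coordinate μ) : IsDependentColoring k q coordinate μ where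
  measurable := measurable_coordinate
  proper := hμ.ae_ne
  stationary := hμ.isStationaryProcess
  dependent := h.isDependent measurable_coordinate

/-- The probability that only two given colors are used on an interval. -/
lemma measureReal_two_colors (hμ : IsColoringLaw q μ) {c d : Fin q} (hcd : c ≠ d) {b : Bool}
    {f : Fin q → Bool} (hf : ∀ s, f s = b ↔ s = c ∨ s = d) (a : ℤ) (n : ℕ) :
    μ.real (wordEvent (fun i x => f (coordinate i x)) a (List.replicate (n + 1) b)) =
      2 ^ (n + 1) / buildingTotal q (n + 1) := by
  -- A proper coloring that uses two colors on an interval alternates there.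
  have key (x : ℤ → Fin q) (hx : ∀ i, coordinate i x ≠ coordinate (i + 1) x) (n : ℕ) : ∀ a,
      x ∈ wordEvent (fun i x => f (coordinate i x)) a (List.replicate (n + 1) b) ↔
        x ∈ wordEvent coordinate a (alternating c d (n + 1)) ∪
          wordEvent coordinate a (alternating d c (n + 1)) := by
    induction n with
    | zero => intro a; simp [wordEvent, alternating, hf]
    | succ n ih =>
      intro a
      have := ih (a + 1)
      have hne := hx a
      rw [List.replicate_succ, wordEvent, Set.mem_inter_iff, ih, Set.mem_ofPred_eq, hf]
      simp only [wordEvent, alternating, Set.mem_union, Set.mem_inter_iff, Set.mem_ofPred_eq]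
      grind
  have hdis : Disjoint (wordEvent (coordinate (S := Fin q)) a (alternating c d (n + 1)))
      (wordEvent coordinate a (alternating d c (n + 1))) := by
    rw [Set.disjoint_left]
    intro x h1 h2
    simp only [wordEvent, alternating, Set.mem_inter_iff, Set.mem_ofPred_eq] at h1 h2
    exact hcd (h1.1.symm.trans h2.1)
  have hae : wordEvent (fun i x => f (coordinate i x)) a (List.replicate (n + 1) b) =ᵐ[μ]
      (wordEvent coordinate a (alternating c d (n + 1)) ∪
          wordEvent coordinate a (alternating d c (n + 1)) : Set (ℤ → Fin q)) := by
    filter_upwards [hμ.ae_ne] with x hx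
    exact propext (key x hx n a)
  rw [measureReal_congr hae, measureReal_union hdis
    (measurableSet_wordEvent_of_measurable measurable_coordinate _ _), hμ, hμ,
    colorProb_alternating hcd, colorProb_alternating hcd.symm]
  ring

lemma hasUniformDescentMarginal {μ : Measure (ℤ → Fin 4)} [IsProbabilityMeasure μ]
    (hμ : IsColoringLaw 4 μ) : HasUniformDescentMarginal coordinate μ := by
  have hf : Measurable fun s : Fin 4 => decide (s = 0 ∨ s = 1) := measurable_of_finite _
  have hJ (i : ℤ) : Measurable fun x : ℤ → Fin 4 =>
      decide (coordinate i x = 0 ∨ coordinate i x = 1) := hf.comp (measurable_coordinate i)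
  have hd := hμ.isDependentColoring hμ.isWordDependent_four
  refine identDistrib_ind (J' := descent) hJ
    (measurable_descent_pi measurableSet_lt_unitInterval) (by simp) (by simp [descent])
    (wordEvent_eq_of_run_eq hJ (measurable_descent_pi measurableSet_lt_unitInterval)
      (hd.dependent.isWordDependent_comp hf)
      (isWordDependent_descent measurableSet_lt_unitInterval _) ?_)
  intro a n
  rw [iidUniform_descent_run]
  cases n with
  | zero => simp [wordEvent]
  | succ n =>
    rw [hμ.measureReal_two_colors (c := 0) (d := 1)
      (f := fun s => decide (s = 0 ∨ s = 1)) (by decide) (by decide), buildingTotal_four]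
    field_simp

lemma hasUniformPeakMarginal {μ : Measure (ℤ → Fin 3)} [IsProbabilityMeasure μ]
    (hμ : IsColoringLaw 3 μ) : HasUniformPeakMarginal coordinate μ := by
  have hf : Measurable fun s : Fin 3 => decide (s = 0) := measurable_of_finite _
  have hJ (i : ℤ) : Measurable fun x : ℤ → Fin 3 => decide (coordinate i x = 0) :=
    hf.comp (measurable_coordinate i)
  have hd := hμ.isDependentColoring hμ.isWordDependent_three
  refine identDistrib_ind (J' := peak) hJ
    (measurable_peak_pi measurableSet_lt_unitInterval) (by simp) (by simp [peak])
    (wordEvent_eq_of_zero_run_eq hJ (measurable_peak_pi measurableSet_lt_unitInterval)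
      (hd.dependent.isWordDependent_comp hf)
      (isWordDependent_peak measurableSet_lt_unitInterval _) (hd.measureReal_pair 0)
      iidUniform_peak_pair ?_)
  intro a n
  rw [iidUniform_peak_zero_run]
  cases n with
  | zero => simp [wordEvent]
  | succ n =>
    rw [hμ.measureReal_two_colors (c := 1) (d := 2) (f := fun s => decide (s = 0)) (by decide)
      (by decide), buildingTotal_three]
    field_simp
    ring

lemma isConditionedOnAvoidingLast {μ : Measure (ℤ → Fin 4)} {ν : Measure (ℤ → Fin 3)}
    [IsProbabilityMeasure μ] [IsProbabilityMeasure ν] (hμ : IsColoringLaw 4 μ)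
    (hν : IsColoringLaw 3 ν) : IsConditionedOnAvoidingLast coordinate ν coordinate μ := by
  intro n
  let A : Set (ℤ → Fin 4) := {x | ∀ i : Fin n, coordinate ((i : ℤ) + 1) x ≠ 3}
  let f : (ℤ → Fin 3) → Fin n → Fin 4 := fun y i => (coordinate ((i : ℤ) + 1) y).castSucc
  let g : (ℤ → Fin 4) → Fin n → Fin 4 := fun x i => coordinate ((i : ℤ) + 1) x
  have hfm : Measurable f := measurable_pi_iff.2 fun i =>
    (measurable_of_finite _).comp (measurable_coordinate _)
  have hgm : Measurable g := measurable_pi_iff.2 fun i => measurable_coordinate _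
  have ht3 := buildingTotal_pos (q := 3) (by norm_num) n
  have ht4 := buildingTotal_pos (q := 4) (by norm_num) n
  let r : ENNReal := ENNReal.ofReal (buildingTotal 3 n / buildingTotal 4 n)
  -- On words avoiding the last color both laws are building numbers over constants, so they are
  -- proportional; comparing total masses then identifies r as the probability of `A`.
  have hprop : (μ.restrict A).map g = r • ν.map f := by
    refine Measure.ext_of_singleton fun w => ?_
    rw [Measure.map_apply hgm (measurableSet_singleton w),
      Measure.restrict_apply (hgm (measurableSet_singleton w)), Measure.smul_apply,
      Measure.map_apply hfm (measurableSet_singleton w), smul_eq_mul]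
    by_cases hw : ∃ i, w i = 3
    · obtain ⟨i, hi⟩ := hw
      have h1 : g ⁻¹' {w} ∩ A = ∅ := by
        ext x
        simp only [Set.mem_inter_iff, Set.mem_preimage, Set.mem_singleton_iff,
          Set.mem_empty_iff_false, iff_false, not_and]
        intro hx hxA
        exact hxA i ((congrFun hx i).trans hi)
      have h2 : f ⁻¹' {w} = ∅ := by
        ext y
        simp only [Set.mem_preimage, Set.mem_singleton_iff, Set.mem_empty_iff_false, iff_false]
        intro hy
        exact (Fin.castSucc_lt_last _).ne ((congrFun hy i).trans hi)
      rw [h1, h2]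
      simp
    · push Not at hw
      have hz (i : Fin n) : ∃ z : Fin 3, z.castSucc = w i :=
        ⟨(w i).castPred (hw i), Fin.castSucc_castPred _ _⟩
      choose z hz using hz
      have h1 : g ⁻¹' {w} ∩ A = wordEvent coordinate 1 (List.ofFn w) := by
        ext x
        rw [mem_wordEvent_ofFn]
        simp only [Set.mem_inter_iff, Set.mem_preimage, Set.mem_singleton_iff, g,
          add_comm (1 : ℤ)]
        refine ⟨fun h => h.1, fun h => ⟨h, fun i hi => hw i ?_⟩⟩
        rw [← hi, ← h]
      have h2 : f ⁻¹' {w} = wordEvent coordinate 1 (List.ofFn z) := by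
        ext y
        rw [mem_wordEvent_ofFn]
        simp only [Set.mem_preimage, Set.mem_singleton_iff, f, add_comm (1 : ℤ), funext_iff,
          ← hz, Fin.castSucc_inj]
      have hwz : List.ofFn w = (List.ofFn z).map Fin.castSucc := by
        rw [List.map_ofFn]
        congr 1
        ext i
        simp [← hz]
      rw [h1, h2, ← ENNReal.toReal_eq_toReal_iff' (by finiteness)
        (ENNReal.mul_ne_top ENNReal.ofReal_ne_top (by finiteness)), ENNReal.toReal_mul,
        ENNReal.toReal_ofReal (by positivity), ← measureReal_def, ← measureReal_def, hμ, hν,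
        hwz, colorProb, colorProb, building_map (Fin.castSucc_injective 3)]
      simp only [List.length_map, List.length_ofFn]
      field_simp
  have hmass : μ A = r := by
    have := congrArg (fun m => m Set.univ) hprop
    simpa [Measure.map_apply hgm, Measure.map_apply hfm] using this
  refine ⟨hfm.aemeasurable, hgm.aemeasurable, ?_⟩
  rw [ProbabilityTheory.cond, Measure.map_smul, hprop, hmass, smul_smul, ENNReal.inv_mul_cancel,
    one_smul]
  · simp only [r, ne_eq, ENNReal.ofReal_eq_zero, not_le]
    positivity
  · exact ENNReal.ofReal_ne_top

end IsColoringLaw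

end ColoringLaw

theorem theorem1p4 :
    (∃ (Ω : Type) (_ : MeasurableSpace Ω) (P : Measure Ω) (X : ℤ → Ω → Fin 4)
       (Ω' : Type) (_ : MeasurableSpace Ω') (P' : Measure Ω') (Y : ℤ → Ω' → Fin 3),
      IsProbabilityMeasure P ∧ IsProbabilityMeasure P' ∧
      IsDependentColoring 1 4 X P ∧ IsDependentColoring 2 3 Y P' ∧
      (IsReversible X P ∧ IsColorSymmetric X P ∧ IsReversible Y P' ∧ IsColorSymmetric Y P') ∧
      HasFairDescentMarginal X P ∧
      HasUniformDescentMarginal X P ∧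
      HasUniformPeakMarginal Y P' ∧
      IsConditionedOnAvoidingLast Y P' X P) ∧
    (∀ (Ω : Type*) [MeasurableSpace Ω] (P : Measure Ω) [IsProbabilityMeasure P]
       (X : ℤ → Ω → Fin 4),
      IsDependentColoring 1 4 X P → HasFairDescentMarginal X P) := by
  refine ⟨?_, fun Ω _ P _ X hX => hX.hasFairDescentMarginal⟩
  obtain ⟨μ, hμ, h4⟩ := exists_isColoringLaw (q := 4) (by norm_num)
  obtain ⟨ν, hν, h3⟩ := exists_isColoringLaw (q := 3) (by norm_num)
  have hX := h4.isDependentColoring h4.isWordDependent_four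
  exact ⟨ℤ → Fin 4, inferInstance, μ, coordinate, ℤ → Fin 3, inferInstance, ν, coordinate,
    hμ, hν, hX, h3.isDependentColoring h3.isWordDependent_three,
    ⟨h4.isReversible, h4.isColorSymmetric, h3.isReversible, h3.isColorSymmetric⟩,
    hX.hasFairDescentMarginal, h4.hasUniformDescentMarginal, h3.hasUniformPeakMarginal,
    h4.isConditionedOnAvoidingLast h3⟩
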